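/- **Conventions.** For a smooth map $f$ defined near a point $x$ of a real vector space, let $\mathrm{ord}_x(f)\in\mathbb N\cup\{\infty\}$ be the least order of a partial derivative of $f$ not vanishing at $x$ ($\infty$ if there is none). For a real function $k$, smooth near $z_0\in\mathbb C^N$, let $$\mathrm{typ}_{z_0}(k)=\sup_{\varphi}\frac{\mathrm{ord}_0\left(k\circ\varphi-k(z_0)\right)}{\mathrm{ord}_0(\varphi-z_0)}\in[0,\infty],$$ the supremum being over all non-constant holomorphic maps $\varphi$ from the unit disc to $\mathbb C^N$ with $\varphi(0)=z_0$; $k$ is of finite type at $z_0$ if $\mathrm{typ}_{z_0}(k)<\infty$. If $D$ is a domain with smooth boundary and $x\in\partial D$, then $\mathrm{typ}_x(\partial D)$ is the type at $x$ of any smooth local defining function of $D$ near $x$; $D$ is of finite type if $\mathrm{typ}_x(\partial D)<\infty$ for all $x\in\partial D$. Such a $D$ is pseudo-convex if at each boundary point the Levi form of a local defining function is non-negative on the complex tangent space. **Setting.** Let $n\ge1$ and $p,m_1,\dots,m_p\ge0$ be integers and let $\Omega\subset\mathbb C^n$ be a bounded domain with smooth boundary. Let $\rho$ be a smooth real function on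 an open neighbourhood $U$ of $\overline\Omega$ with $\Omega=\{z\in U:\rho(z)<0\}$ and $\nabla\rho\ne0$ on $\partial\Omega$. Assume that $\rho$ is plurisubharmonic on $U$ and of finite type at every point of $\overline\Omega$. For $1\le i\le p$ let $h_i$ be a non-negative smooth plurisubharmonic function on $\mathbb C^{m_i}$ such that (Condition II) - $h_i(w_i)=0\Leftrightarrow w_i=0$; $\nabla h_i(w_i)\neq0$ if $w_i\ne0$; and $h_i(w_i)\to+\infty$ as $|w_i|\to\infty$; - $\log h_i$ is plurisubharmonic, and $h_i$ is strictly plurisubharmonic outside the origin; - $h_i$ is of finite type at the origin. Let $\widetilde\Omega=\{(z,w)\in\Omega\times\mathbb C^{m_1}\times\dots\times\mathbb C^{m_p}:\ \rho(z)+\sum_{i=1}^p h_i(w_i)<0\}$. **Conclusion.** $\widetilde\Omega$ is a bounded domain with smooth boundary, and it is pseudo-convex and of finite type. More precisely, for every $(z,w)\in\partial\widetilde\Omega$, $$\mathrm{typ}_{(z,w)}(\partial\widetilde\Omega)\le\max\Big\{\mathrm{typ}_{z}(\partial\Omega),\ \max_{1\le i\le p}\mathrm{typ}_0(h_i)\Big\}\quad\text{if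 } w=0,$$ $$\mathrm{typ}_{(z,w)}(\partial\widetilde\Omega)\le\max\Big\{2\,\mathrm{typ}_{z}(\rho),\ \max_{i\,:\,w_i=0}\mathrm{typ}_0(h_i)\Big\}\quad\text{if } w\neq0$$ (a maximum over an empty set of indices is $0$). -/

import Mathlib

open scoped ContDiff

noncomputable section

namespace Hartogs

variable {E : Type*} [NormedAddCommGroup E] [NormedSpace ℂ E]

/-- The order of vanishing `ord_x (f)` of a smooth map `f` at `x`: the least `k` such that some
partial derivative of order `k` of `f` is non-zero at `x`, and `∞` if there is none. -/
def order {D G : Type*} [NormedAddCommGroup D] [NormedSpace ℝ D]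
    [NormedAddCommGroup G] [NormedSpace ℝ G] (f : D → G) (x : D) : ℕ∞ :=
  ⨅ (k : ℕ) (_ : iteratedFDeriv ℝ k f x ≠ 0), (k : ℕ∞)

/-- `φ` is (on the unit disc) a non-constant holomorphic disc centred at `z₀`. -/
structure IsDiscAt (φ : ℂ → E) (z₀ : E) : Prop where
  holomorphic : DifferentiableOn ℂ φ (Metric.ball 0 1)
  center : φ 0 = z₀
  nonconstant : ∃ ζ ∈ Metric.ball (0 : ℂ) 1, φ ζ ≠ z₀

/-- The type `typ_{z₀} (k)` of a function `k`, smooth near `z₀`: the supremum of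
`ord₀ (k ∘ φ - k z₀) / ord₀ (φ - z₀)` over the non-constant holomorphic discs `φ`
centred at `z₀`. -/
def typ (k : E → ℝ) (z₀ : E) : ENNReal :=
  ⨆ (φ : ℂ → E) (_ : IsDiscAt φ z₀),
    ((order (fun ζ => k (φ ζ) - k z₀) 0 : ℕ∞) : ENNReal) /
      ((order (fun ζ => φ ζ - z₀) 0 : ℕ∞) : ENNReal)

/-- The Levi form `∑ ∂²f/∂z_j∂z̄_k (z) t_j t̄_k`, written through the real second derivative. -/
def leviForm (f : E → ℝ) (z t : E) : ℝ :=
  (fderiv ℝ (fderiv ℝ f) z t t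
    + fderiv ℝ (fderiv ℝ f) z (Complex.I • t) (Complex.I • t)) / 4

/-- Plurisubharmonicity on the open set `U` of a function that is smooth on `U`. -/
def IsPshOn (f : E → ℝ) (U : Set E) : Prop :=
  ∀ z ∈ U, ∀ t : E, 0 ≤ leviForm f z t

/-- Strict plurisubharmonicity on the open set `U` of a function that is smooth on `U`. -/
def IsStrictlyPshOn (f : E → ℝ) (U : Set E) : Prop :=
  ∀ z ∈ U, ∀ t : E, t ≠ 0 → 0 < leviForm f z t

/-- `r` is a smooth local defining function of `Ω` near the boundary point `x`. -/
def IsLocalDefiningFunction (Ω : Set E) (x : E) (r : E → ℝ) : Prop :=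
  r x = 0 ∧ fderiv ℝ r x ≠ 0 ∧
    ∃ U : Set E, IsOpen U ∧ x ∈ U ∧ ContDiffOn ℝ ∞ r U ∧ ∀ z ∈ U, z ∈ Ω ↔ r z < 0

/-- A bounded domain with smooth boundary. -/
structure IsSmoothBoundedDomain (Ω : Set E) : Prop where
  isOpen : IsOpen Ω
  isConnected : IsConnected Ω
  isBounded : Bornology.IsBounded Ω
  smooth_boundary : ∀ x ∈ frontier Ω, ∃ r, IsLocalDefiningFunction Ω x r

/-- Pseudo-convexity of a domain with smooth boundary: at every boundary point, the Levi form of a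
local defining function `r` (the choice of `r` does not matter) is non-negative on the complex
tangent space of the boundary. -/
def IsPseudoconvex (Ω : Set E) : Prop :=
  ∀ x ∈ frontier Ω, ∃ r, IsLocalDefiningFunction Ω x r ∧
    ∀ t : E, fderiv ℝ r x t = 0 → fderiv ℝ r x (Complex.I • t) = 0 → 0 ≤ leviForm r x t

/-- The type at `x` of the boundary of a domain with smooth boundary: the type at `x` of a local
defining function. All local defining functions at `x` have the same type, so that the infimum
only serves to pick this common value. -/
def bdryTyp (Ω : Set E) (x : E) : ENNReal :=
  ⨅ (r : E → ℝ) (_ : IsLocalDefiningFunction Ω x r), typ r x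

/-- The boundary of `Ω` is of finite type at each of its points. -/
def IsOfFiniteType (Ω : Set E) : Prop :=
  ∀ x ∈ frontier Ω, bdryTyp Ω x < ⊤

/-- `ρ` is a (global) smooth defining function of `Ω`, defined on the open
neighbourhood `U` of the closure of `Ω`. -/
structure IsDefiningFunctionOn (Ω : Set E) (ρ : E → ℝ) (U : Set E) : Prop where
  isOpen : IsOpen U
  closure_subset : closure Ω ⊆ U
  smooth : ContDiffOn ℝ ∞ ρ U
  mem_iff : ∀ z ∈ U, z ∈ Ω ↔ ρ z < 0
  gradient_ne_zero : ∀ z ∈ frontier Ω, fderiv ℝ ρ z ≠ 0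

/-- Condition II for one of the functions `h_i`. In `log_psh` the origin is left out because
`log h_i` is `-∞` there, where plurisubharmonicity requires nothing. -/
structure ConditionIIAt (h : E → ℝ) : Prop where
  smooth : ContDiff ℝ ∞ h
  nonneg : ∀ w, 0 ≤ h w
  psh : IsPshOn h Set.univ
  eq_zero_iff : ∀ w, h w = 0 ↔ w = 0
  gradient_ne_zero : ∀ w, w ≠ 0 → fderiv ℝ h w ≠ 0
  tendsto_atTop : Filter.Tendsto h (Bornology.cobounded E) Filter.atTop
  log_psh : IsPshOn (fun w => Real.log (h w)) {w | w ≠ 0}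
  strictly_psh : IsStrictlyPshOn h {w | w ≠ 0}
  finite_type : typ h 0 < ⊤

/-- Condition II for `h (w) = ∑ i, h_i (w_i)`. -/
def ConditionII {ι : Type*} {F : ι → Type*} [∀ i, NormedAddCommGroup (F i)]
    [∀ i, NormedSpace ℂ (F i)] (h : ∀ i, F i → ℝ) : Prop :=
  ∀ i, ConditionIIAt (h i)

/-- The set of the `(z, w)` with `ρ (z) + ∑ i, h_i (w_i) < 0`. As `ρ` need only be defined near the
closure of `Ω`, and as `h` is non-negative, `z` is taken in `Ω`. -/
def hartogsDomain {ι : Type*} [Fintype ι] {F : ι → Type*} (Ω : Set E) (ρ : E → ℝ)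
    (h : ∀ i, F i → ℝ) : Set (E × (∀ i, F i)) :=
  {x | x.1 ∈ Ω ∧ ρ x.1 + ∑ i, h i (x.2 i) < 0}

end Hartogs

end

/-!
Restrict a plurisubharmonic `f` and a nonnegative smooth `g` with `g (z) = 0` to a holomorphic disc.
If their leading homogeneous parts at `z` cancelled, the leading part `-q` of `f` would be
subharmonic with `q ≥ 0` homogeneous of some degree `n`. Along each circle `q'' ≤ -n² q ≤ 0`, so `q`
is a nonnegative concave periodic function of the angle, hence constant, hence zero. So nothing
cancels, and the order of `f + g` is at most the order of `f` and the order of `g`.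

This discards the `h_i` with `w_i = 0`. Where `w_i ≠ 0`, strict plurisubharmonicity of `h_i` bounds
`‖∂φ_i‖²`, and plurisubharmonicity of `log h_i` bounds `‖∂(h_i ∘ φ_i)‖²`, by a multiple of the Levi
form of `F ∘ φ`, where `F = ρ + ∑ h_i`. Hence `F ∘ φ` has at most twice the order of `φ_i`, of
`h_i ∘ φ_i`, and therefore of `ρ ∘ φ_1`; these factors give the `2` in the estimate.

The domain is connected because every fibre over `Ω` is a bounded sublevel set of `∑ h_i`, whose
only critical point is the origin.
-/

namespace Hartogs

open Filter Topology Asymptotics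

section Symmetry

variable {D G : Type*} [NormedAddCommGroup D] [NormedSpace ℝ D]
  [NormedAddCommGroup G] [NormedSpace ℝ G] {f : D → G} {x : D}

theorem contDiffAt_iteratedFDeriv_apply {m n : ℕ} (hf : ContDiffAt ℝ (m + n : ℕ) f x)
    (v : Fin n → D) : ContDiffAt ℝ m (fun y => iteratedFDeriv ℝ n f y v) x :=
  (ContinuousMultilinearMap.apply ℝ (fun _ : Fin n => D) G v).contDiff.comp_contDiffAt x
    (hf.iteratedFDeriv_right (by norm_cast))

theorem iteratedFDeriv_succ_succ_apply {n : ℕ} (hf : ContDiffAt ℝ (n + 2 : ℕ) f x)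
    (v : Fin (n + 2) → D) :
    iteratedFDeriv ℝ (n + 2) f x v =
      fderiv ℝ (fderiv ℝ fun y => iteratedFDeriv ℝ n f y (Fin.tail (Fin.tail v))) x
        (v 0) (v 1) := by
  set g : D → G := fun y => iteratedFDeriv ℝ n f y (Fin.tail (Fin.tail v))
  have hg : ContDiffAt ℝ 2 g x :=
    contDiffAt_iteratedFDeriv_apply (by rwa [add_comm]) _
  have hfirst : (fun y => iteratedFDeriv ℝ (n + 1) f y (Fin.tail v)) =ᶠ[𝓝 x]
      fun y => fderiv ℝ g y (v 1) :=
    (hf.eventually (by simp [-Nat.cast_add])).mono fun y hy =>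
      (hy.differentiableAt_iteratedFDeriv
        (by norm_cast; omega)).iteratedFDeriv_succ_apply_left'
  rw [(hf.differentiableAt_iteratedFDeriv
      (by norm_cast; omega)).iteratedFDeriv_succ_apply_left', hfirst.fderiv_eq,
    fderiv_clm_apply ((hg.fderiv_right (m := 1) (by norm_num)).differentiableAt one_ne_zero)
      (differentiableAt_const _)]
  simp

theorem iteratedFDeriv_comp_swap {n : ℕ} (hf : ContDiffAt ℝ (n + 1 : ℕ) f x) (i : Fin n)
    (v : Fin (n + 1) → D) :
    iteratedFDeriv ℝ (n + 1) f x (v ∘ Equiv.swap i.castSucc i.succ) =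
      iteratedFDeriv ℝ (n + 1) f x v := by
  induction n generalizing x with
  | zero => exact i.elim0
  | succ n ih =>
    induction i using Fin.cases with
    | zero =>
      have htail : Fin.tail (Fin.tail (v ∘ Equiv.swap 0 1)) = Fin.tail (Fin.tail v) := by
        ext j
        exact congrArg v (Equiv.swap_apply_of_ne_of_ne (Fin.succ_ne_zero _)
          (by simp [Fin.ext_iff]))
      have hg : ContDiffAt ℝ 2 (fun y => iteratedFDeriv ℝ n f y (Fin.tail (Fin.tail v))) x :=
        contDiffAt_iteratedFDeriv_apply (by rwa [add_comm]) _
      simpa [iteratedFDeriv_succ_succ_apply hf, htail] using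
        hg.isSymmSndFDerivAt (by simp) (v 1) (v 0)
    | succ i =>
      have htail : Fin.tail (v ∘ Equiv.swap i.succ.castSucc i.succ.succ) =
          Fin.tail v ∘ Equiv.swap i.castSucc i.succ := by
        ext j
        exact congrArg v ((Fin.succEmb (n + 1)).swap_apply i.castSucc i.succ j)
      have hd : DifferentiableAt ℝ (iteratedFDeriv ℝ (n + 1) f) x :=
        hf.differentiableAt_iteratedFDeriv (by norm_cast; omega)
      have hsymm : (fun y => iteratedFDeriv ℝ (n + 1) f y
          (Fin.tail v ∘ Equiv.swap i.castSucc i.succ)) =ᶠ[𝓝 x]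
          fun y => iteratedFDeriv ℝ (n + 1) f y (Fin.tail v) := by
        filter_upwards [hf.eventually (by simp [-Nat.cast_add])] with y hy
        exact ih (hy.of_le (by norm_cast; omega)) i _
      rw [hd.iteratedFDeriv_succ_apply_left', hd.iteratedFDeriv_succ_apply_left', htail,
        hsymm.fderiv_eq]
      exact congrArg _ (congrArg v
        (Equiv.swap_apply_of_ne_of_ne (by simp [Fin.ext_iff]) (by simp [Fin.ext_iff])))

theorem iteratedFDeriv_comp_perm {n : ℕ} (hf : ContDiffAt ℝ n f x) (σ : Equiv.Perm (Fin n))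
    (v : Fin n → D) : iteratedFDeriv ℝ n f x (v ∘ σ) = iteratedFDeriv ℝ n f x v := by
  cases n with
  | zero => exact congrArg _ (Subsingleton.elim _ _)
  | succ n =>
    have hσ : σ ∈ Submonoid.closure
        (Set.range fun i : Fin n => Equiv.swap i.castSucc i.succ) :=
      Equiv.Perm.mclosure_swap_castSucc_succ n ▸ Submonoid.mem_top σ
    induction hσ using Submonoid.closure_induction generalizing v with
    | mem _ hs =>
      obtain ⟨i, rfl⟩ := hs
      exact iteratedFDeriv_comp_swap hf i v
    | one => rfl
    | mul s t _ _ hs ht => rw [Equiv.Perm.coe_mul, ← Function.comp_assoc, ht, hs]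

end Symmetry

section Order

variable {D G : Type*} [NormedAddCommGroup D] [NormedSpace ℝ D]
  [NormedAddCommGroup G] [NormedSpace ℝ G] {f g : D → G} {x : D} {k m n : ℕ}

theorem le_order_iff : (n : ℕ∞) ≤ order f x ↔ ∀ k < n, iteratedFDeriv ℝ k f x = 0 := by
  simp only [order, le_iInf_iff, Nat.cast_le]
  exact forall_congr' fun k => not_imp_comm.trans (by rw [not_le])

theorem le_order_succ_iff :
    ((n + 1 : ℕ) : ℕ∞) ≤ order f x ↔ (n : ℕ∞) ≤ order f x ∧ iteratedFDeriv ℝ n f x = 0 := by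
  simp only [le_order_iff, Nat.forall_lt_succ_right]

theorem iteratedFDeriv_zero_eq_zero_iff : iteratedFDeriv ℝ 0 f x = 0 ↔ f x = 0 := by
  rw [← norm_eq_zero, norm_iteratedFDeriv_zero, norm_eq_zero]

theorem one_le_order_iff : 1 ≤ order f x ↔ f x = 0 := by
  rw [← Nat.cast_one, le_order_iff]
  simp only [Nat.lt_one_iff, forall_eq, iteratedFDeriv_zero_eq_zero_iff]

theorem order_congr (h : f =ᶠ[𝓝 x] g) : order f x = order g x := by
  simp only [order, (h.iteratedFDeriv ℝ _).eq_of_nhds]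

theorem succ_le_order_iff_fderiv :
    ((n + 1 : ℕ) : ℕ∞) ≤ order f x ↔ f x = 0 ∧ (n : ℕ∞) ≤ order (fderiv ℝ f) x := by
  have hsucc (k : ℕ) :
      iteratedFDeriv ℝ (k + 1) f x = 0 ↔ iteratedFDeriv ℝ k (fderiv ℝ f) x = 0 := by
    rw [← norm_eq_zero, ← norm_iteratedFDeriv_fderiv, norm_eq_zero]
  simp only [le_order_iff, ← iteratedFDeriv_zero_eq_zero_iff (f := f)]
  refine ⟨fun h => ⟨h 0 n.succ_pos, fun k hk => (hsucc k).1 (h _ (by omega))⟩, ?_⟩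
  rintro ⟨hzero, h⟩ (_ | k) hk
  exacts [hzero, (hsucc k).2 (h k (by omega))]

theorem le_order_sub (hf : ContDiffAt ℝ n f x) (hg : ContDiffAt ℝ n g x)
    (hfn : (n : ℕ∞) ≤ order f x) (hgn : (n : ℕ∞) ≤ order g x) :
    (n : ℕ∞) ≤ order (fun y => f y - g y) x := by
  rw [le_order_iff] at *
  intro k hk
  have hkn : (k : ℕ∞ω) ≤ n := by exact_mod_cast hk.le
  rw [fun_iteratedFDeriv_sub_apply (hf.of_le hkn) (hg.of_le hkn), hfn k hk, hgn k hk, sub_zero]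

theorem isBigO_iteratedFDeriv_of_le_order (hf : ContDiffAt ℝ (k + m : ℕ) f x)
    (h : ((k + m : ℕ) : ℕ∞) ≤ order f x) :
    iteratedFDeriv ℝ k f =O[𝓝 x] fun y => ‖y - x‖ ^ m := by
  induction m generalizing k with
  | zero => simpa using (hf.continuousAt_iteratedFDeriv le_rfl).isBigO_one ℝ
  | succ m ih =>
    have hdiff : ∀ᶠ y in 𝓝 x, DifferentiableAt ℝ (iteratedFDeriv ℝ k f) y :=
      (hf.eventually (by simp [-Nat.cast_add])).mono fun y hy =>
        hy.differentiableAt_iteratedFDeriv (by norm_cast; omega)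
    have hfderiv : fderiv ℝ (iteratedFDeriv ℝ k f) =O[𝓝 x] fun y => ‖y - x‖ ^ (m : ℝ) := by
      simp only [Real.rpow_natCast]
      refine .trans (isBigO_of_le _ fun y => norm_fderiv_iteratedFDeriv.le) (@ih (k + 1) ?_ ?_)
      all_goals rwa [add_right_comm]
    simpa only [← Nat.cast_succ, Real.rpow_natCast] using
      isBigO_norm_rpow_add_one_of_fderiv_of_apply_eq_zero m.cast_nonneg hdiff hfderiv
        (le_order_iff.1 h k (by omega))

theorem isBigO_of_le_order (hf : ContDiffAt ℝ n f x) (h : (n : ℕ∞) ≤ order f x) :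
    f =O[𝓝 x] fun y => ‖y - x‖ ^ n :=
  .trans (isBigO_of_le _ fun _ => norm_iteratedFDeriv_zero.ge)
    (isBigO_iteratedFDeriv_of_le_order (k := 0) (by rwa [zero_add]) (by rwa [zero_add]))

end Order

section LeadingPart

variable {D G : Type*} [NormedAddCommGroup D] [NormedSpace ℝ D]
  [NormedAddCommGroup G] [NormedSpace ℝ G] {f : D → G} {x : D} {k n : ℕ}

/-- The homogeneous part of degree `n` of the Taylor expansion of `f` at `x`, as a function of the
displacement from `x`. It is the leading part of `f` at `x` when `n ≤ order f x`. -/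
noncomputable def leadingPart (f : D → G) (x : D) (n : ℕ) (y : D) : G :=
  (n.factorial : ℝ)⁻¹ • iteratedFDeriv ℝ n f x fun _ => y

theorem contDiff_leadingPart {N : ℕ∞ω} : ContDiff ℝ N (leadingPart f x n) :=
  ((iteratedFDeriv ℝ n f x).contDiff.comp (contDiff_pi' fun _ => contDiff_id)).const_smul _

theorem leadingPart_add {g : D → G} (hf : ContDiffAt ℝ n f x) (hg : ContDiffAt ℝ n g x) (y : D) :
    leadingPart (fun z => f z + g z) x n y = leadingPart f x n y + leadingPart g x n y := by
  simp only [leadingPart, fun_iteratedFDeriv_add_apply hf hg, add_apply, smul_add]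

theorem leadingPart_smul (t : ℝ) (y : D) :
    leadingPart f x n (t • y) = t ^ n • leadingPart f x n y := by
  have := (iteratedFDeriv ℝ n f x).map_smul_univ (fun _ => t) fun _ => y
  simp only [Finset.prod_const, Finset.card_univ, Fintype.card_fin] at this
  rw [leadingPart, leadingPart, this, smul_comm]

theorem iteratedFDeriv_leadingPart_smul (t : ℝ) (y : D) :
    t ^ k • iteratedFDeriv ℝ k (leadingPart f x n) (t • y) =
      t ^ n • iteratedFDeriv ℝ k (leadingPart f x n) y := by
  have hk : ContDiff ℝ k (leadingPart f x n) := contDiff_leadingPart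
  have hhom : (fun z => leadingPart f x n (t • z)) = t ^ n • leadingPart f x n :=
    funext (leadingPart_smul t)
  rw [← iteratedFDeriv_const_smul_apply (a := t ^ n) hk.contDiffAt, ← hhom]
  exact (congrFun (iteratedFDeriv_comp_const_smul t hk) y).symm

theorem iteratedFDeriv_leadingPart (hf : ContDiffAt ℝ n f x) (y : D) :
    iteratedFDeriv ℝ n (leadingPart f x n) y = iteratedFDeriv ℝ n f x := by
  ext v
  set A := iteratedFDeriv ℝ n f x
  have hsymm (σ : Equiv.Perm (Fin n)) : (A fun i => v (σ i)) = A v :=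
    iteratedFDeriv_comp_perm hf σ v
  have hdef : leadingPart f x n = fun y => ((n.factorial : ℝ)⁻¹ • A) fun _ => y := rfl
  rw [hdef, ContinuousMultilinearMap.iteratedFDeriv_comp_diagonal]
  simp only [smul_apply, hsymm, Finset.sum_const, Finset.card_univ, Fintype.card_perm,
    Fintype.card_fin]
  rw [← Nat.cast_smul_eq_nsmul ℝ, smul_inv_smul₀ (by positivity)]

theorem le_order_leadingPart : (n : ℕ∞) ≤ order (leadingPart f x n) 0 := by
  refine le_order_iff.2 fun k hk => ?_
  have h := iteratedFDeriv_leadingPart_smul (f := f) (x := x) (k := k) (n := n) 2 0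
  have hpow : (2 : ℝ) ^ k ≠ 2 ^ n := (pow_lt_pow_right₀ one_lt_two hk).ne
  rw [smul_zero, ← sub_eq_zero, ← sub_smul] at h
  exact (smul_eq_zero.1 h).resolve_left (sub_ne_zero.2 hpow)

theorem le_order_sub_leadingPart (hf : ContDiffAt ℝ n f x) (h : (n : ℕ∞) ≤ order f x) :
    ((n + 1 : ℕ) : ℕ∞) ≤ order (fun y => f y - leadingPart f x n (y - x)) x := by
  have hQ : ContDiff ℝ n fun y => leadingPart f x n (y - x) :=
    contDiff_leadingPart.comp (contDiff_id.sub contDiff_const)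
  refine le_order_succ_iff.2 ⟨le_order_sub hf hQ.contDiffAt h ?_, ?_⟩
  · rw [le_order_iff]
    simp only [iteratedFDeriv_comp_sub, sub_self]
    exact le_order_iff.1 le_order_leadingPart
  · rw [fun_iteratedFDeriv_sub_apply hf hQ.contDiffAt, iteratedFDeriv_comp_sub,
      iteratedFDeriv_leadingPart hf, sub_self]

theorem isBigO_iteratedFDeriv_sub_leadingPart {m : ℕ} (hf : ContDiffAt ℝ (n + 1 : ℕ) f x)
    (h : (n : ℕ∞) ≤ order f x) (hkm : k + m = n + 1) :
    (fun y => iteratedFDeriv ℝ k f y - iteratedFDeriv ℝ k (leadingPart f x n) (y - x))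
      =O[𝓝 x] fun y => ‖y - x‖ ^ m := by
  have hQ (N : ℕ) : ContDiff ℝ N fun y => leadingPart f x n (y - x) :=
    contDiff_leadingPart.comp (contDiff_id.sub contDiff_const)
  have hord := le_order_sub_leadingPart (hf.of_le (by norm_cast; omega)) h
  have hkn : (k : ℕ∞ω) ≤ (n + 1 : ℕ) := by norm_cast; omega
  have heq : iteratedFDeriv ℝ k (fun y => f y - leadingPart f x n (y - x)) =ᶠ[𝓝 x]
      fun y => iteratedFDeriv ℝ k f y - iteratedFDeriv ℝ k (leadingPart f x n) (y - x) := by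
    filter_upwards [hf.eventually (by simp [-Nat.cast_add])] with y hy
    rw [fun_iteratedFDeriv_sub_apply (hy.of_le hkn) (hQ k).contDiffAt, iteratedFDeriv_comp_sub]
  refine (isBigO_iteratedFDeriv_of_le_order ?_ ?_).congr' heq .rfl
  · rw [hkm]; exact hf.sub (hQ _).contDiffAt
  · rwa [hkm]

theorem tendsto_add_smul_nhdsGT_zero (x y : D) :
    Tendsto (fun t : ℝ => x + t • y) (𝓝[>] 0) (𝓝 x) :=
  ((by fun_prop : Continuous fun t : ℝ => x + t • y).tendsto' 0 x (by simp)).mono_left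
    nhdsWithin_le_nhds

theorem tendsto_iteratedFDeriv_leadingPart (hf : ContDiffAt ℝ (n + 1 : ℕ) f x)
    (h : (n : ℕ∞) ≤ order f x) (hk : k ≤ n + 1) (y : D) :
    Tendsto (fun t : ℝ => (t ^ k / t ^ n) • iteratedFDeriv ℝ k f (x + t • y)) (𝓝[>] 0)
      (𝓝 (iteratedFDeriv ℝ k (leadingPart f x n) y)) := by
  set Q := leadingPart f x n with hQ
  obtain ⟨m, hkm⟩ := Nat.exists_eq_add_of_le hk
  have hrem : (fun t : ℝ => iteratedFDeriv ℝ k f (x + t • y) - iteratedFDeriv ℝ k Q (t • y))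
      =O[𝓝[>] 0] fun t => t ^ m := by
    have := (isBigO_iteratedFDeriv_sub_leadingPart hf h hkm.symm).comp_tendsto
      (tendsto_add_smul_nhdsGT_zero x y)
    simp only [Function.comp_def, add_sub_cancel_left] at this
    refine this.trans (.of_bound (‖y‖ ^ m) (.of_forall fun t => ?_))
    rw [norm_smul, mul_pow, norm_mul, norm_pow, norm_pow, norm_norm, norm_norm, norm_pow, mul_comm]
  have hscaled := (isBigO_refl (fun t : ℝ => t ^ k / t ^ n) (𝓝[>] 0)).smul hrem
  have hzero : Tendsto (fun t : ℝ => (t ^ k / t ^ n) • t ^ m) (𝓝[>] 0) (𝓝 0) := by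
    refine (tendsto_id.mono_left nhdsWithin_le_nhds).congr' ?_
    filter_upwards [self_mem_nhdsWithin] with t (ht : 0 < t)
    rw [smul_eq_mul, div_mul_eq_mul_div, ← pow_add, ← hkm, pow_succ', id_eq,
      mul_div_cancel_right₀ _ (by positivity)]
  refine tendsto_sub_nhds_zero_iff.1 ((hscaled.trans_tendsto hzero).congr' ?_)
  filter_upwards [self_mem_nhdsWithin] with t (ht : 0 < t)
  have hhom : (t ^ k / t ^ n) • iteratedFDeriv ℝ k Q (t • y) = iteratedFDeriv ℝ k Q y := by
    rw [div_eq_inv_mul, mul_smul, hQ, iteratedFDeriv_leadingPart_smul,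
      inv_smul_smul₀ (by positivity)]
  rw [smul_sub, hhom]

theorem tendsto_leadingPart (hf : ContDiffAt ℝ (n + 1 : ℕ) f x) (h : (n : ℕ∞) ≤ order f x)
    (y : D) :
    Tendsto (fun t : ℝ => (t ^ n)⁻¹ • f (x + t • y)) (𝓝[>] 0) (𝓝 (leadingPart f x n y)) := by
  simpa [Function.comp_def] using
    ((ContinuousMultilinearMap.apply ℝ (fun _ : Fin 0 => D) G 0).continuous.tendsto _).comp
      (tendsto_iteratedFDeriv_leadingPart hf h n.succ.zero_le y)

theorem le_order_succ_of_leadingPart_eq_zero (hf : ContDiffAt ℝ n f x)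
    (h : (n : ℕ∞) ≤ order f x) (hQ : leadingPart f x n = 0) :
    ((n + 1 : ℕ) : ℕ∞) ≤ order f x :=
  le_order_succ_iff.2 ⟨h, by
    rw [← iteratedFDeriv_leadingPart hf 0, hQ, Pi.zero_def, iteratedFDeriv_fun_zero, Pi.zero_apply]⟩

theorem isLittleO_norm_sub_pow {D : Type*} [NormedAddCommGroup D] {x : D} {m n : ℕ} (h : m < n) :
    (fun y : D => ‖y - x‖ ^ n) =o[𝓝 x] fun y => ‖y - x‖ ^ m :=
  (isLittleO_pow_pow h).comp_tendsto (tendsto_norm_sub_self x)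

theorem le_order_succ_of_isLittleO (hf : ContDiffAt ℝ (n + 1 : ℕ) f x) (h : (n : ℕ∞) ≤ order f x)
    (ho : f =o[𝓝 x] fun y => ‖y - x‖ ^ n) : ((n + 1 : ℕ) : ℕ∞) ≤ order f x := by
  have hfn : ContDiffAt ℝ n f x := hf.of_le (by norm_cast; omega)
  refine le_order_succ_of_leadingPart_eq_zero hfn h (funext fun y => ?_)
  refine tendsto_nhds_unique (tendsto_leadingPart hf h y) (IsLittleO.tendsto_inv_smul_nhds_zero ?_)
  refine (ho.comp_tendsto (tendsto_add_smul_nhdsGT_zero x y)).trans_isBigO ?_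
  refine .of_bound (‖y‖ ^ n) (.of_forall fun t => le_of_eq ?_)
  rw [Function.comp_apply, add_sub_cancel_left, norm_smul, mul_pow, norm_mul, norm_pow, norm_pow,
    norm_norm, norm_norm, norm_pow, mul_comm]

theorem le_order_iff_isBigO (hf : ContDiffAt ℝ n f x) :
    (n : ℕ∞) ≤ order f x ↔ f =O[𝓝 x] fun y => ‖y - x‖ ^ n := by
  refine ⟨isBigO_of_le_order hf, fun h => ?_⟩
  suffices ∀ m ≤ n, (m : ℕ∞) ≤ order f x from this n le_rfl
  intro m hm
  induction m with
  | zero => simp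
  | succ m ih =>
    exact le_order_succ_of_isLittleO (hf.of_le (by exact_mod_cast hm)) (ih (by omega))
      (h.trans_isLittleO (isLittleO_norm_sub_pow hm))

theorem le_order_of_isLittleO (hf : ContDiffAt ℝ (n + 1 : ℕ) f x)
    (h : f =o[𝓝 x] fun y => ‖y - x‖ ^ n) : ((n + 1 : ℕ) : ℕ∞) ≤ order f x :=
  le_order_succ_of_isLittleO hf
    ((le_order_iff_isBigO (hf.of_le (by norm_cast; omega))).2 h.isBigO) h

theorem order_le_order_of_isBigO {G' : Type*} [NormedAddCommGroup G'] [NormedSpace ℝ G']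
    {g : D → G'} (hf : ContDiffAt ℝ ∞ f x) (hg : ContDiffAt ℝ ∞ g x) (h : f =O[𝓝 x] g) :
    order g x ≤ order f x :=
  ENat.forall_natCast_le_iff_le.1 fun _ hn =>
    (le_order_iff_isBigO (contDiffAt_infty.1 hf _)).2
      (h.trans (isBigO_of_le_order (contDiffAt_infty.1 hg _) hn))

end LeadingPart

section Levi

variable {E : Type*} [NormedAddCommGroup E] [NormedSpace ℂ E] {f g : E → ℝ} {z : E}

theorem leviForm_eq_iteratedFDeriv (f : E → ℝ) (z t : E) :
    leviForm f z t = (iteratedFDeriv ℝ 2 f z (fun _ => t) +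
      iteratedFDeriv ℝ 2 f z fun _ => Complex.I • t) / 4 := by
  simp only [leviForm, iteratedFDeriv_two_apply]

theorem leviForm_smul (f : E → ℝ) (z t : E) (c : ℂ) :
    leviForm f z (c • t) = ‖c‖ ^ 2 * leviForm f z t := by
  have hc : c • t = c.re • t + c.im • Complex.I • t := by
    conv_lhs => rw [← Complex.re_add_im c, add_smul, mul_smul]
    rfl
  have hIc : Complex.I • c • t = c.re • Complex.I • t - c.im • t := by
    rw [hc, smul_add, smul_comm Complex.I c.re, smul_comm Complex.I c.im, smul_smul Complex.I,
      Complex.I_mul_I, neg_one_smul, smul_neg, sub_eq_add_neg]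
  rw [leviForm, leviForm, hIc, hc, ← Complex.normSq_eq_norm_sq, Complex.normSq_apply]
  simp only [map_add, map_sub, map_smul, add_apply, sub_apply, smul_apply, smul_eq_mul]
  ring

theorem leviForm_const (c : ℝ) (z t : E) : leviForm (fun _ => c) z t = 0 := by
  simp [leviForm_eq_iteratedFDeriv, iteratedFDeriv_const_of_ne]

theorem leviForm_add (hf : ContDiffAt ℝ 2 f z) (hg : ContDiffAt ℝ 2 g z) (t : E) :
    leviForm (fun y => f y + g y) z t = leviForm f z t + leviForm g z t := by
  simp only [leviForm_eq_iteratedFDeriv, fun_iteratedFDeriv_add_apply hf hg, add_apply]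
  ring

theorem leviForm_sub_const (c : ℝ) (t : E) :
    leviForm (fun y => f y - c) z t = leviForm f z t := by
  have hfderiv : fderiv ℝ (fun y => f y - c) = fderiv ℝ f := funext fun _ => fderiv_sub_const c
  rw [leviForm, hfderiv, leviForm]

theorem leviForm_sum {ι : Type*} (s : Finset ι) {f : ι → E → ℝ}
    (hf : ∀ i ∈ s, ContDiffAt ℝ 2 (f i) z) (t : E) :
    leviForm (fun y => ∑ i ∈ s, f i y) z t = ∑ i ∈ s, leviForm (f i) z t := by
  classical
  induction s using Finset.induction_on with
  | empty => simpa using leviForm_const 0 z t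
  | insert a s ha ih =>
    simp only [Finset.forall_mem_insert] at hf
    simp only [Finset.sum_insert ha]
    rw [leviForm_add hf.1 (.sum hf.2), ih hf.2]

theorem differentiableAt_fderiv {D G : Type*} [NormedAddCommGroup D] [NormedSpace ℝ D]
    [NormedAddCommGroup G] [NormedSpace ℝ G] {f : D → G} {x : D} (hf : ContDiffAt ℝ 2 f x) :
    DifferentiableAt ℝ (fderiv ℝ f) x :=
  (hf.fderiv_right (m := 1) (by norm_num)).differentiableAt one_ne_zero

theorem eventually_differentiableAt {D G : Type*} [NormedAddCommGroup D] [NormedSpace ℝ D]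
    [NormedAddCommGroup G] [NormedSpace ℝ G] {f : D → G} {x : D} (hf : ContDiffAt ℝ 2 f x) :
    ∀ᶠ y in 𝓝 x, DifferentiableAt ℝ f y :=
  (hf.eventually (by simp)).mono fun _ hy => hy.differentiableAt two_ne_zero

theorem fderiv_fderiv_apply {D G : Type*} [NormedAddCommGroup D] [NormedSpace ℝ D]
    [NormedAddCommGroup G] [NormedSpace ℝ G] {f : D → G} {x : D} (hf : ContDiffAt ℝ 2 f x)
    (t s : D) : fderiv ℝ (fderiv ℝ f) x t s = fderiv ℝ (fun y => fderiv ℝ f y s) x t := by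
  rw [fderiv_clm_apply (differentiableAt_fderiv hf) (differentiableAt_const s)]
  simp

theorem leviForm_comp {D : Type*} [NormedAddCommGroup D] [NormedSpace ℂ D] {φ : D → E} {ζ : D}
    (hf : ContDiffAt ℝ 2 f (φ ζ)) (hφ : ContDiffAt ℂ 2 φ ζ) (t : D) :
    leviForm (fun ξ => f (φ ξ)) ζ t = leviForm f (φ ζ) (fderiv ℂ φ ζ t) := by
  have hφ' : DifferentiableAt ℂ (fderiv ℂ φ) ζ :=
    (hφ.fderiv_right (m := 1) (by norm_num)).differentiableAt one_ne_zero
  have hfst (s : D) : (fun ξ => fderiv ℝ (fun ξ => f (φ ξ)) ξ s) =ᶠ[𝓝 ζ]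
      fun ξ => fderiv ℝ f (φ ξ) (fderiv ℂ φ ξ s) := by
    filter_upwards [hφ.eventually (by simp),
      hφ.continuousAt.eventually (eventually_differentiableAt hf)] with ξ hξ hfξ
    exact congrArg (fun T => T s) (hfξ.hasFDerivAt.comp ξ
      ((hξ.differentiableAt two_ne_zero).hasFDerivAt.restrictScalars ℝ)).fderiv
  have hsnd (s : D) : fderiv ℝ (fderiv ℝ fun ξ => f (φ ξ)) ζ s s =
      fderiv ℝ (fderiv ℝ f) (φ ζ) (fderiv ℂ φ ζ s) (fderiv ℂ φ ζ s) +
        fderiv ℝ f (φ ζ) (fderiv ℂ (fderiv ℂ φ) ζ s s) := by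
    have houter := (differentiableAt_fderiv hf).hasFDerivAt.comp ζ
      ((hφ.differentiableAt two_ne_zero).hasFDerivAt.restrictScalars ℝ)
    have hinner : HasFDerivAt (fun ξ => fderiv ℂ φ ξ s)
        (((fderiv ℂ (fderiv ℂ φ) ζ).flip s).restrictScalars ℝ) ζ := by
      simpa using (hφ'.hasFDerivAt.clm_apply (hasFDerivAt_const s ζ)).restrictScalars ℝ
    have hcomp : ContDiffAt ℝ 2 (fun ξ => f (φ ξ)) ζ := hf.comp ζ (hφ.restrict_scalars ℝ)
    rw [fderiv_fderiv_apply hcomp, (hfst s).fderiv_eq]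
    refine (congrArg (fun T => T s) (houter.clm_apply hinner).fderiv).trans ?_
    simp [add_comm]
  have hI : fderiv ℂ (fderiv ℂ φ) ζ (Complex.I • t) (Complex.I • t) =
      -fderiv ℂ (fderiv ℂ φ) ζ t t := by
    simp [smul_smul]
  rw [leviForm, leviForm, hsnd, hsnd, hI, map_neg, map_smul]
  ring

theorem leviForm_log {h : E → ℝ} (hh : ContDiffAt ℝ 2 h z) (hz : h z ≠ 0) (t : E) :
    leviForm (fun y => Real.log (h y)) z t = leviForm h z t / h z -
      (fderiv ℝ h z t ^ 2 + fderiv ℝ h z (Complex.I • t) ^ 2) / (4 * h z ^ 2) := by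
  have hsnd (s : E) : fderiv ℝ (fderiv ℝ fun y => Real.log (h y)) z s s =
      fderiv ℝ (fderiv ℝ h) z s s / h z - fderiv ℝ h z s ^ 2 / h z ^ 2 := by
    have hfst : (fun y => fderiv ℝ (fun y => Real.log (h y)) y s) =ᶠ[𝓝 z]
        fun y => (h y)⁻¹ * fderiv ℝ h y s := by
      filter_upwards [eventually_differentiableAt hh, hh.continuousAt.eventually_ne hz]
        with y hy hne
      simp [fderiv.log hy hne]
    rw [fderiv_fderiv_apply (hh.log hz), hfst.fderiv_eq]
    have hinv := (hasDerivAt_inv hz).comp_hasFDerivAt z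
      (hh.differentiableAt two_ne_zero).hasFDerivAt
    have happly := (differentiableAt_fderiv hh).hasFDerivAt.clm_apply (hasFDerivAt_const s z)
    refine (congrArg (fun T => T s) (hinv.mul happly).fderiv).trans ?_
    simp
    field_simp
    ring
  rw [leviForm, leviForm, hsnd, hsnd]
  field_simp
  ring

theorem sq_fderiv_le_of_leviForm_log_nonneg {h : E → ℝ} {t : E} (hh : ContDiffAt ℝ 2 h z)
    (hz : 0 < h z) (hlog : 0 ≤ leviForm (fun y => Real.log (h y)) z t) :
    fderiv ℝ h z t ^ 2 + fderiv ℝ h z (Complex.I • t) ^ 2 ≤ 4 * h z * leviForm h z t := by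
  rw [leviForm_log hh hz.ne', sub_nonneg, div_le_div_iff₀ (by positivity) hz] at hlog
  refine le_of_mul_le_mul_right (hlog.trans_eq ?_) hz
  ring

theorem leviForm_eq_deriv_deriv (hf : ContDiffAt ℝ 2 f z) (t : E) :
    leviForm f z t = (deriv (deriv fun s : ℝ => f (z + s • t)) 0 +
      deriv (deriv fun s : ℝ => f (z + s • Complex.I • t)) 0) / 4 := by
  have hsnd (v : E) : deriv (deriv fun s : ℝ => f (z + s • v)) 0 =
      fderiv ℝ (fderiv ℝ f) z v v := by
    have hline (s : ℝ) : HasDerivAt (fun s : ℝ => z + s • v) v s := by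
      simpa using ((hasDerivAt_id s).smul_const v).const_add z
    have htendsto : Tendsto (fun s : ℝ => z + s • v) (𝓝 0) (𝓝 z) :=
      (by fun_prop : Continuous fun s : ℝ => z + s • v).tendsto' 0 z (by simp)
    have hfst : deriv (fun s : ℝ => f (z + s • v)) =ᶠ[𝓝 0] fun s => fderiv ℝ f (z + s • v) v := by
      filter_upwards [htendsto.eventually (eventually_differentiableAt hf)] with s hs
      exact (hs.hasFDerivAt.comp_hasDerivAt s (hline s)).deriv
    have happly : HasFDerivAt (fun y => fderiv ℝ f y v) ((fderiv ℝ (fderiv ℝ f) z).flip v) z := by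
      simpa using (differentiableAt_fderiv hf).hasFDerivAt.clm_apply (hasFDerivAt_const v z)
    rw [hfst.deriv_eq]
    exact (happly.comp_hasDerivAt_of_eq 0 (hline 0) (by simp)).deriv
  rw [hsnd, hsnd, leviForm]

theorem isBigO_leviForm {n : ℕ} (hf : ContDiffAt ℝ (n + 2 : ℕ) f z)
    (h : ((n + 2 : ℕ) : ℕ∞) ≤ order f z) (t : E) :
    (fun y => leviForm f y t) =O[𝓝 z] fun y => ‖y - z‖ ^ n := by
  rw [add_comm] at hf h
  have hiter := isBigO_iteratedFDeriv_of_le_order hf h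
  have happly (v : E) : (fun y => iteratedFDeriv ℝ 2 f y fun _ => v) =O[𝓝 z]
      fun y => ‖y - z‖ ^ n :=
    (IsBigO.of_bound (‖v‖ ^ 2) (.of_forall fun y => by
      simpa [mul_comm] using (iteratedFDeriv ℝ 2 f y).le_opNorm fun _ => v)).trans hiter
  simp only [leviForm_eq_iteratedFDeriv, div_eq_inv_mul]
  exact ((happly t).add (happly _)).const_mul_left _

theorem tendsto_leviForm_leadingPart {n : ℕ} (hf : ContDiffAt ℝ (n + 1 : ℕ) f z)
    (h : (n : ℕ∞) ≤ order f z) (hn : n ≠ 0) (y t : E) :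
    Tendsto (fun s : ℝ => s ^ 2 / s ^ n * leviForm f (z + s • y) t) (𝓝[>] 0)
      (𝓝 (leviForm (leadingPart f z n) y t)) := by
  have hlim := tendsto_iteratedFDeriv_leadingPart (k := 2) hf h (by omega) y
  have happly (v : E) : Tendsto (fun s : ℝ => s ^ 2 / s ^ n *
      iteratedFDeriv ℝ 2 f (z + s • y) fun _ => v) (𝓝[>] 0)
      (𝓝 (iteratedFDeriv ℝ 2 (leadingPart f z n) y fun _ => v)) :=
    ((ContinuousMultilinearMap.apply ℝ (fun _ : Fin 2 => E) ℝ fun _ => v).continuous.tendsto _).comp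
      hlim
  simp only [leviForm_eq_iteratedFDeriv]
  refine (((happly t).add (happly (Complex.I • t))).div_const 4).congr fun s => ?_
  ring

end Levi

section NoCancellation

theorem le_of_concaveOn_univ_of_nonneg {V : Type*} [AddCommGroup V] [Module ℝ V] {q : V → ℝ}
    (hq : ConcaveOn ℝ Set.univ q) (hnonneg : ∀ x, 0 ≤ q x) (x y : V) : q x ≤ q y := by
  have hlim : Tendsto (fun t : ℝ => (1 - t) * q x) (𝓝[>] 0) (𝓝 (q x)) :=
    ((by fun_prop : Continuous fun t : ℝ => (1 - t) * q x).tendsto' 0 _ (by simp)).mono_left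
      nhdsWithin_le_nhds
  refine le_of_tendsto hlim ?_
  filter_upwards [Ioo_mem_nhdsGT one_pos] with t ⟨ht0, ht1⟩
  have hy : (1 - t) • x + t • (x + t⁻¹ • (y - x)) = y := by
    rw [smul_add, smul_inv_smul₀ ht0.ne']
    module
  calc (1 - t) * q x ≤ (1 - t) • q x + t • q (x + t⁻¹ • (y - x)) :=
        le_add_of_nonneg_right (mul_nonneg ht0.le (hnonneg _))
    _ ≤ q y := by
        simpa only [hy] using hq.2 (Set.mem_univ x) (Set.mem_univ (x + t⁻¹ • (y - x)))
          (sub_nonneg.2 ht1.le) ht0.le (sub_add_cancel 1 t)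

theorem eq_zero_of_nonneg_of_deriv_deriv_le {q : ℝ → ℝ} {c : ℝ} (hc : 0 < c)
    (hq : Differentiable ℝ q) (hq' : Differentiable ℝ (deriv q)) (hnonneg : ∀ θ, 0 ≤ q θ)
    (hle : ∀ θ, deriv (deriv q) θ ≤ -(c * q θ)) : q = 0 := by
  have hconcave : ConcaveOn ℝ Set.univ q := concaveOn_univ_of_deriv2_nonpos hq hq' fun θ =>
    (hle θ).trans (neg_nonpos.2 (mul_nonneg hc.le (hnonneg θ)))
  have hconst : q = fun _ => q 0 := funext fun θ =>
    le_antisymm (le_of_concaveOn_univ_of_nonneg hconcave hnonneg _ _)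
      (le_of_concaveOn_univ_of_nonneg hconcave hnonneg _ _)
  funext θ
  have hzero : deriv (deriv q) θ = 0 := by
    rw [hconst]
    simp
  have hcq : c * q θ ≤ 0 := by linarith [hle θ]
  exact le_antisymm (nonpos_of_mul_nonpos_right hcq hc) (hnonneg θ)

theorem eq_zero_of_homogeneous_of_leviForm_nonpos {Q : ℂ → ℝ} {n : ℕ} (hn : n ≠ 0)
    (hQ : ContDiff ℝ 2 Q) (hhom : ∀ (t : ℝ) x, Q (t • x) = t ^ n • Q x) (hnonneg : ∀ x, 0 ≤ Q x)
    (hlevi : ∀ x t, leviForm Q x t ≤ 0) : Q = 0 := by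
  set V : ℂ → ℝ := fun ξ => Q (Complex.exp ξ) with hV
  have hVdiff : ContDiff ℝ 2 V := hQ.comp ((Complex.contDiff_exp (𝕜 := ℂ)).restrict_scalars ℝ)
  have hrad (ξ : ℂ) : deriv (deriv fun s : ℝ => V (ξ + s • (1 : ℂ))) 0 = n ^ 2 * V ξ := by
    have heq : (fun s : ℝ => V (ξ + s • (1 : ℂ))) = fun s => Real.exp (n * s) * V ξ := by
      funext s
      rw [Real.exp_nat_mul, ← smul_eq_mul, ← hhom, Complex.real_smul, Complex.real_smul, mul_one,
        Complex.ofReal_exp, mul_comm, ← Complex.exp_add]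
    have hexp : (deriv fun s : ℝ => Real.exp (n * s)) = fun s => n * Real.exp (n * s) := by
      funext s
      simp only [deriv_comp_mul_left (n : ℝ) Real.exp, Real.deriv_exp, smul_eq_mul]
    rw [heq, deriv_mul_const_field', hexp, deriv_mul_const_field, deriv_const_mul_field, hexp]
    simp only [mul_zero, Real.exp_zero]
    ring
  have hVlevi (ξ : ℂ) : leviForm V ξ 1 ≤ 0 := by
    rw [leviForm_comp hQ.contDiffAt Complex.contDiff_exp.contDiffAt]
    exact hlevi _ _
  have hcircle (ζ : ℂ) : (fun θ : ℝ => V (ζ + θ • Complex.I)) = 0 := by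
    have hq : ContDiff ℝ 2 fun θ : ℝ => V (ζ + θ • Complex.I) := by fun_prop
    refine eq_zero_of_nonneg_of_deriv_deriv_le (c := (n : ℝ) ^ 2) (by positivity)
      (hq.differentiable two_ne_zero) (hq.differentiable_deriv_two) (fun θ => hnonneg _)
      fun θ => ?_
    have h := hVlevi (ζ + θ • Complex.I)
    rw [leviForm_eq_deriv_deriv hVdiff.contDiffAt, hrad, smul_eq_mul, mul_one] at h
    have hshift : deriv (deriv fun s : ℝ => V (ζ + θ • Complex.I + s • Complex.I)) 0 =
        deriv (deriv fun θ : ℝ => V (ζ + θ • Complex.I)) θ := by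
      simp only [add_assoc, ← add_smul]
      have hd := funext (deriv_comp_const_add (fun s : ℝ => V (ζ + s • Complex.I)) θ)
      rw [hd, deriv_comp_const_add, add_zero]
    rw [hshift] at h
    linarith
  funext x
  rcases eq_or_ne x 0 with rfl | hx
  · simpa [hn] using hhom 0 0
  · simpa [hV, Complex.exp_log hx] using congrFun (hcircle (Complex.log x)) 0

theorem leadingPart_nonneg {D : Type*} [NormedAddCommGroup D] [NormedSpace ℝ D] {f : D → ℝ}
    {x : D} {n : ℕ} (hf : ContDiffAt ℝ (n + 1 : ℕ) f x) (h : (n : ℕ∞) ≤ order f x)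
    (hnonneg : ∀ᶠ y in 𝓝 x, 0 ≤ f y) (y : D) : 0 ≤ leadingPart f x n y := by
  refine ge_of_tendsto (tendsto_leadingPart hf h y) ?_
  filter_upwards [(tendsto_add_smul_nhdsGT_zero x y).eventually hnonneg, self_mem_nhdsWithin]
    with t hft (ht : 0 < t)
  exact smul_nonneg (by positivity) hft

theorem leviForm_leadingPart_nonneg {E : Type*} [NormedAddCommGroup E] [NormedSpace ℂ E]
    {f : E → ℝ} {x : E} {n : ℕ} (hf : ContDiffAt ℝ (n + 1 : ℕ) f x) (h : (n : ℕ∞) ≤ order f x)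
    (hn : n ≠ 0) (hlevi : ∀ᶠ y in 𝓝 x, ∀ t, 0 ≤ leviForm f y t) (y t : E) :
    0 ≤ leviForm (leadingPart f x n) y t := by
  refine ge_of_tendsto (tendsto_leviForm_leadingPart hf h hn y t) ?_
  filter_upwards [(tendsto_add_smul_nhdsGT_zero x y).eventually hlevi, self_mem_nhdsWithin]
    with s hfs (hs : 0 < s)
  exact mul_nonneg (by positivity) (hfs t)

variable {f g : ℂ → ℝ} {z : ℂ}

theorem le_order_of_le_order_add {n : ℕ} (hf : ContDiffAt ℝ ∞ f z)
    (hg : ContDiffAt ℝ ∞ g z) (hlevi : ∀ᶠ ζ in 𝓝 z, ∀ t, 0 ≤ leviForm f ζ t)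
    (hnonneg : ∀ᶠ ζ in 𝓝 z, 0 ≤ g ζ) (hgz : g z = 0)
    (h : (n : ℕ∞) ≤ order (fun ζ => f ζ + g ζ) z) : (n : ℕ∞) ≤ order g z := by
  have hfN := contDiffAt_infty.1 hf
  have hgN := contDiffAt_infty.1 hg
  induction n with
  | zero => simp
  | succ n ih =>
    obtain ⟨hn, hzero⟩ := le_order_succ_iff.1 h
    have hgn := ih hn
    rcases eq_or_ne n 0 with rfl | hn0
    · exact one_le_order_iff.2 hgz
    have hfn : (n : ℕ∞) ≤ order f z := by
      simpa using le_order_sub ((hfN n).add (hgN n)) (hgN n) hn hgn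
    have hsum (y : ℂ) : leadingPart f z n y + leadingPart g z n y = 0 := by
      rw [← leadingPart_add (hfN n) (hgN n), leadingPart, hzero, zero_apply, smul_zero]
    have hsuper (y t : ℂ) : leviForm (leadingPart g z n) y t ≤ 0 := by
      have hadd := leviForm_add (f := leadingPart f z n) (g := leadingPart g z n) (z := y)
        contDiff_leadingPart.contDiffAt contDiff_leadingPart.contDiffAt t
      simp only [hsum, leviForm_const] at hadd
      linarith [leviForm_leadingPart_nonneg (hfN _) hfn hn0 hlevi y t]
    refine le_order_succ_of_leadingPart_eq_zero (hgN n) hgn ?_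
    exact eq_zero_of_homogeneous_of_leviForm_nonpos hn0 contDiff_leadingPart
      leadingPart_smul (leadingPart_nonneg (hgN _) hgn hnonneg) hsuper

theorem order_add_le_right (hf : ContDiffAt ℝ ∞ f z) (hg : ContDiffAt ℝ ∞ g z)
    (hlevi : ∀ᶠ ζ in 𝓝 z, ∀ t, 0 ≤ leviForm f ζ t) (hnonneg : ∀ᶠ ζ in 𝓝 z, 0 ≤ g ζ)
    (hgz : g z = 0) : order (fun ζ => f ζ + g ζ) z ≤ order g z :=
  ENat.forall_natCast_le_iff_le.1 fun _ => le_order_of_le_order_add hf hg hlevi hnonneg hgz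

theorem order_add_le_left (hf : ContDiffAt ℝ ∞ f z) (hg : ContDiffAt ℝ ∞ g z)
    (hlevi : ∀ᶠ ζ in 𝓝 z, ∀ t, 0 ≤ leviForm f ζ t) (hnonneg : ∀ᶠ ζ in 𝓝 z, 0 ≤ g ζ)
    (hgz : g z = 0) : order (fun ζ => f ζ + g ζ) z ≤ order f z := by
  refine ENat.forall_natCast_le_iff_le.1 fun n hn => ?_
  simpa using le_order_sub (contDiffAt_infty.1 (hf.add hg) n) (contDiffAt_infty.1 hg n) hn
    (le_order_of_le_order_add hf hg hlevi hnonneg hgz hn)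

theorem order_le_two_mul_order {W : Type*} [NormedAddCommGroup W] [NormedSpace ℝ W] {ψ : ℂ → W}
    (hf : ContDiffAt ℝ ∞ f z) (hψ : ContDiffAt ℝ ∞ ψ z) (hψz : ψ z = 0) {C : ℝ}
    (h : ∀ᶠ ζ in 𝓝 z, ‖fderiv ℝ ψ ζ‖ ^ 2 ≤ C * leviForm f ζ 1) :
    order f z ≤ 2 * order ψ z := by
  have hstep (m : ℕ) (hm : ((2 * m + 1 : ℕ) : ℕ∞) ≤ order f z) :
      ((m + 1 : ℕ) : ℕ∞) ≤ order ψ z := by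
    refine succ_le_order_iff_fderiv.2 ⟨hψz, ?_⟩
    obtain _ | k := m
    · simp
    refine le_order_of_isLittleO (hψ.fderiv_right (by exact_mod_cast le_top)) ?_
    have hlevi : (fun ζ => leviForm f ζ 1) =O[𝓝 z] fun ζ => ‖ζ - z‖ ^ (2 * k + 1) :=
      isBigO_leviForm (contDiffAt_infty.1 hf _) hm 1
    have hsq : (fun ζ => ‖fderiv ℝ ψ ζ‖ ^ 2) =O[𝓝 z] fun ζ => leviForm f ζ 1 := by
      refine .of_bound |C| (h.mono fun ζ hζ => ?_)
      rw [norm_pow, norm_norm, Real.norm_eq_abs, ← abs_mul]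
      exact hζ.trans (le_abs_self _)
    have hsq' := (hsq.trans hlevi).trans_isLittleO (isLittleO_norm_sub_pow (2 * k).lt_succ_self)
    refine (IsLittleO.of_pow (n := 2) ?_ two_ne_zero).of_norm_left
    simpa only [pow_mul', Pi.pow_def] using hsq'
  by_contra! hlt
  have hfin : order ψ z ≠ ⊤ := fun htop => by simp [htop] at hlt
  obtain ⟨m, hm⟩ := ENat.ne_top_iff_exists.1 hfin
  rw [← hm] at hlt hstep
  have := hstep m (by exact_mod_cast Order.add_one_le_of_lt hlt)
  norm_cast at this
  omega

end NoCancellation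

section DefiningFunction

theorem exists_tendsto_isBigO_sub_zeros {V : Type*} [NormedAddCommGroup V] [NormedSpace ℝ V]
    [CompleteSpace V] {r : V → ℝ} {r' : V →L[ℝ] ℝ} {x : V} (hr : HasStrictFDerivAt r r' x)
    (hr' : r' ≠ 0) (hx : r x = 0) :
    ∃ π : V → V, Tendsto π (𝓝 x) (𝓝 x) ∧ (∀ᶠ y in 𝓝 x, r (π y) = 0) ∧
      (fun y => π y - y) =O[𝓝 x] r := by
  obtain ⟨w, hw⟩ := DFunLike.ne_iff.1 hr'
  set v := (r' w)⁻¹ • w with hv_def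
  have hv : r' v = 1 := by
    rw [hv_def, map_smul, smul_eq_mul, inv_mul_cancel₀ hw]
  -- `G` straightens `r` to the linear form `r'`; `π` moves along `v` in these coordinates.
  set G : V → V := fun y => y + (r y - r' (y - x)) • v with hG_def
  have hrG (y : V) : r' (G y - x) = r y := by
    simp only [hG_def, add_sub_right_comm, map_add, map_smul, hv, smul_eq_mul]
    ring
  have hGx : G x = x := by simp [hG_def, hx]
  have hG : HasStrictFDerivAt G (ContinuousLinearEquiv.refl ℝ V : V →L[ℝ] V) x := by
    have hdiff := hr.sub (r'.hasStrictFDerivAt.comp x (hasStrictFDerivAt_sub_const x))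
    refine ((hasStrictFDerivAt_id x).add (hdiff.smul_const v)).congr_fderiv ?_
    ext y
    simp
  set H := hG.localInverse G _ x
  have hH : HasStrictFDerivAt H _ x := hGx ▸ hG.to_localInverse
  have hHx : H x = x := by simpa [hGx] using hG.localInverse_apply_image
  have hGt : Tendsto G (𝓝 x) (𝓝 x) := by simpa only [hGx] using hG.continuousAt.tendsto
  have hshift : Tendsto (fun y => G y - r y • v) (𝓝 x) (𝓝 x) := by
    simpa [hx] using hGt.sub (hr.continuousAt.tendsto.smul_const v)
  refine ⟨fun y => H (G y - r y • v), ?_, ?_, ?_⟩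
  · simpa only [hHx, Function.comp_def] using hH.continuousAt.tendsto.comp hshift
  · filter_upwards [hshift.eventually (by simpa only [hGx] using hG.eventually_right_inverse)]
      with y hy
    rw [← hrG, hy, sub_right_comm, map_sub, hrG, map_smul, hv, smul_eq_mul, mul_one, sub_self]
  · have hlip := hH.isBigO_sub.comp_tendsto (hshift.prodMk_nhds hGt)
    have hleft : (fun y => H (G y - r y • v) - H (G y)) =ᶠ[𝓝 x] fun y => H (G y - r y • v) - y :=
      hG.eventually_left_inverse.mono fun y hy => congrArg _ hy
    refine (hlip.congr' hleft .rfl).trans (.of_bound ‖v‖ (.of_forall fun y => ?_))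
    simp [norm_smul, mul_comm]

theorem isBigO_of_eventually_eq_zero {V : Type*} [NormedAddCommGroup V] [NormedSpace ℝ V]
    [CompleteSpace V] {r s : V → ℝ} {r' s' : V →L[ℝ] ℝ} {x : V} (hr : HasStrictFDerivAt r r' x)
    (hs : HasStrictFDerivAt s s' x) (hr' : r' ≠ 0) (hx : r x = 0)
    (h : ∀ᶠ y in 𝓝 x, r y = 0 → s y = 0) : s =O[𝓝 x] r := by
  obtain ⟨π, hπ, hzero, hdist⟩ := exists_tendsto_isBigO_sub_zeros hr hr' hx
  have hlip := (hs.isBigO_sub.comp_tendsto (hπ.prodMk_nhds tendsto_id)).trans hdist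
  refine hlip.neg_left.congr' ?_ .rfl
  filter_upwards [hzero, hπ.eventually h] with y hy hsy
  simp [hsy hy]

theorem eq_zero_of_mem_frontier {X : Type*} [TopologicalSpace X] {Ω : Set X} {r : X → ℝ} {x : X}
    (hΩ : IsOpen Ω) (hx : x ∈ frontier Ω) (hr : ContinuousAt r x)
    (h : ∀ᶠ y in 𝓝 x, y ∈ Ω ↔ r y < 0) : r x = 0 := by
  rw [hΩ.frontier_eq] at hx
  refine le_antisymm ?_ (not_lt.1 fun hlt => hx.2 (h.self_of_nhds.2 hlt))
  refine le_of_tendsto_of_frequently hr ?_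
  exact ((mem_closure_iff_frequently.1 hx.1).and_eventually h).mono fun y hy => (hy.2.1 hy.1).le

variable {E : Type*} [NormedAddCommGroup E] [NormedSpace ℂ E] {Ω U : Set E} {x : E}
  {r r₁ r₂ ρ : E → ℝ}

theorem IsLocalDefiningFunction.contDiffAt (h : IsLocalDefiningFunction Ω x r) :
    ContDiffAt ℝ ∞ r x := by
  obtain ⟨_, _, U, hU, hx, hr, _⟩ := h
  exact hr.contDiffAt (hU.mem_nhds hx)

theorem IsLocalDefiningFunction.eventually_mem_iff (h : IsLocalDefiningFunction Ω x r) :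
    ∀ᶠ y in 𝓝 x, y ∈ Ω ↔ r y < 0 := by
  obtain ⟨_, _, U, hU, hx, _, hmem⟩ := h
  exact eventually_of_mem (hU.mem_nhds hx) hmem

theorem IsLocalDefiningFunction.eventually_eq_zero (h₁ : IsLocalDefiningFunction Ω x r₁)
    (h₂ : IsLocalDefiningFunction Ω x r₂) : ∀ᶠ y in 𝓝 x, r₁ y = 0 → r₂ y = 0 := by
  have hgrad : ∀ᶠ y in 𝓝 x, fderiv ℝ r₁ y ≠ 0 :=
    (h₁.contDiffAt.fderiv_right (m := ∞) le_rfl).continuousAt.eventually_ne h₁.2.1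
  have hcont : ∀ᶠ y in 𝓝 x, ContinuousAt r₂ y :=
    ((contDiffAt_infty.1 h₂.contDiffAt 0).eventually (by simp)).mono fun y hy => hy.continuousAt
  filter_upwards [hgrad, hcont, h₁.eventually_mem_iff, h₂.eventually_mem_iff,
    h₁.eventually_mem_iff.eventually_nhds, h₂.eventually_mem_iff.eventually_nhds]
    with y hy hcont hm₁ hm₂ hmem₁ hmem₂ hy₁
  refine le_antisymm (not_lt.1 fun hpos => hy ?_) (not_lt.1 ?_)
  · -- if `r₂ y` were positive, the zero `y` of `r₁` would be a local minimum
    have hmin : IsLocalMin r₁ y := by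
      filter_upwards [hmem₁, hmem₂, hcont.eventually (lt_mem_nhds hpos)] with u hu₁ hu₂ hupos
      rw [hy₁]
      exact not_lt.1 (mt (hu₂.1 ∘ hu₁.2) hupos.not_gt)
    exact hmin.fderiv_eq_zero
  · rw [← hm₂, hm₁, hy₁]
    exact lt_irrefl 0

theorem IsLocalDefiningFunction.isBigO [CompleteSpace E] (h₁ : IsLocalDefiningFunction Ω x r₁)
    (h₂ : IsLocalDefiningFunction Ω x r₂) : r₂ =O[𝓝 x] r₁ :=
  isBigO_of_eventually_eq_zero (h₁.contDiffAt.hasStrictFDerivAt (by simp))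
    (h₂.contDiffAt.hasStrictFDerivAt (by simp)) h₁.2.1 h₁.1 (h₁.eventually_eq_zero h₂)

theorem IsDefiningFunctionOn.contDiffAt (h : IsDefiningFunctionOn Ω ρ U) (hx : x ∈ U) :
    ContDiffAt ℝ ∞ ρ x :=
  h.smooth.contDiffAt (h.isOpen.mem_nhds hx)

theorem IsDefiningFunctionOn.eq_zero (h : IsDefiningFunctionOn Ω ρ U) (hΩ : IsOpen Ω)
    (hx : x ∈ frontier Ω) : ρ x = 0 :=
  have hxU := h.closure_subset hx.1
  eq_zero_of_mem_frontier hΩ hx (h.contDiffAt hxU).continuousAt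
    (eventually_of_mem (h.isOpen.mem_nhds hxU) h.mem_iff)

theorem IsDefiningFunctionOn.isLocalDefiningFunction (h : IsDefiningFunctionOn Ω ρ U)
    (hΩ : IsOpen Ω) (hx : x ∈ frontier Ω) : IsLocalDefiningFunction Ω x ρ :=
  ⟨h.eq_zero hΩ hx, h.gradient_ne_zero x hx, U, h.isOpen, h.closure_subset hx.1, h.smooth,
    h.mem_iff⟩

theorem IsDefiningFunctionOn.isPseudoconvex (h : IsDefiningFunctionOn Ω ρ U) (hΩ : IsOpen Ω)
    (hpsh : IsPshOn ρ U) : IsPseudoconvex Ω := fun x hx =>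
  ⟨ρ, h.isLocalDefiningFunction hΩ hx, fun t _ _ => hpsh x (h.closure_subset hx.1) t⟩

end DefiningFunction

section Connectedness

theorem isPreconnected_sublevel {V : Type*} [NormedAddCommGroup V] [NormedSpace ℝ V]
    [ProperSpace V] {H : V → ℝ} (hH : Continuous H) {a : V} {c : ℝ}
    (hb : Bornology.IsBounded {w | H w < c}) (hcrit : ∀ w, w ≠ a → fderiv ℝ H w ≠ 0) :
    IsPreconnected {w | H w < c} := by
  refine isPreconnected_of_forall a fun w hw => ?_
  set S := {w | H w < c}
  have hS : IsOpen S := isOpen_lt hH continuous_const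
  set C := connectedComponentIn S w
  have hCS : C ⊆ S := connectedComponentIn_subset S w
  have hwC : w ∈ C := mem_connectedComponentIn hw
  have hCo : IsOpen C := hS.connectedComponentIn
  have hC : IsPreconnected C := isPreconnected_connectedComponentIn
  -- the minimum of `H` over `closure C` is attained in `C`, hence at the critical point `a`
  obtain ⟨m, hm, hmin⟩ := (hb.subset hCS).isCompact_closure.exists_isMinOn
    ⟨w, subset_closure hwC⟩ hH.continuousOn
  have hmS : m ∈ S := (show H m ≤ H w from hmin (subset_closure hwC)).trans_lt hw
  have hmC : m ∈ C := by
    have hp : IsPreconnected (insert m C) :=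
      hC.subset_closure (Set.subset_insert _ _) (Set.insert_subset hm subset_closure)
    exact hp.subset_connectedComponentIn (Set.mem_insert_of_mem _ hwC)
      (Set.insert_subset hmS hCS) (Set.mem_insert _ _)
  have hloc : IsLocalMin H m := (hmin.on_subset subset_closure).isLocalMin (hCo.mem_nhds hmC)
  obtain rfl : m = a := by_contra fun hne => hcrit m hne hloc.fderiv_eq_zero
  exact ⟨C, hCS, hmC, hwC, hC⟩

theorem isPreconnected_of_fibers {Z W : Type*} [TopologicalSpace Z] [TopologicalSpace W]
    {A : Set (Z × W)} {B : Set Z} {w₀ : W} (hB : IsPreconnected B) (hA : Prod.fst '' A ⊆ B)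
    (hsection : ∀ z ∈ B, (z, w₀) ∈ A) (hfiber : ∀ z ∈ B, IsPreconnected {w | (z, w) ∈ A}) :
    IsPreconnected A := by
  rcases A.eq_empty_or_nonempty with rfl | ⟨x₀, hx₀⟩
  · exact isPreconnected_empty
  have hx₀B := hA (Set.mem_image_of_mem _ hx₀)
  refine isPreconnected_of_forall (x₀.1, w₀) fun x hx => ?_
  have hxB := hA (Set.mem_image_of_mem _ hx)
  refine ⟨(fun z => (z, w₀)) '' B ∪ Prod.mk x.1 '' {w | (x.1, w) ∈ A}, ?_,
    .inl ⟨x₀.1, hx₀B, rfl⟩, .inr ⟨x.2, hx, rfl⟩, ?_⟩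
  · rintro _ (⟨z, hz, rfl⟩ | ⟨w, hw, rfl⟩)
    exacts [hsection z hz, hw]
  · refine (hB.image _ (by fun_prop)).union (x.1, w₀) ⟨x.1, hxB, rfl⟩ ?_
      ((hfiber _ hxB).image _ (by fun_prop))
    exact ⟨w₀, hsection _ hxB, rfl⟩

end Connectedness

section HartogsFun

variable {E ι : Type*} {F : ι → Type*}

/-- The function `ρ (z) + ∑ i ∈ S, h_i (w_i)`. It defines the Hartogs domain when `S` is the set of
all indices; the estimate of the type at a boundary point `(z, w)` also uses the part where `S` is
the set of the indices with `w_i ≠ 0`. -/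
def hartogsFun (ρ : E → ℝ) (h : ∀ i, F i → ℝ) (S : Finset ι) (x : E × (∀ i, F i)) : ℝ :=
  ρ x.1 + ∑ i ∈ S, h i (x.2 i)

theorem hartogsFun_univ_eq_add [Fintype ι] [DecidableEq ι] (ρ : E → ℝ) (h : ∀ i, F i → ℝ)
    (S : Finset ι) (x : E × (∀ i, F i)) :
    hartogsFun ρ h Finset.univ x = hartogsFun ρ h S x + ∑ i ∈ Sᶜ, h i (x.2 i) := by
  rw [hartogsFun, hartogsFun, add_assoc, Finset.sum_add_sum_compl]

variable [NormedAddCommGroup E] [NormedSpace ℂ E] [∀ i, NormedAddCommGroup (F i)]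
  [∀ i, NormedSpace ℂ (F i)]

/-- The projection `(z, w) ↦ w_i`. -/
noncomputable def proj (E : Type*) [NormedAddCommGroup E] [NormedSpace ℂ E] (F : ι → Type*)
    [∀ i, NormedAddCommGroup (F i)] [∀ i, NormedSpace ℂ (F i)] (i : ι) :
    (E × (∀ i, F i)) →L[ℂ] F i :=
  (ContinuousLinearMap.proj i).comp (ContinuousLinearMap.snd ℂ E (∀ i, F i))

variable {ρ : E → ℝ} {h : ∀ i, F i → ℝ} {S : Finset ι} {x : E × (∀ i, F i)}

theorem contDiffAt_hartogsFun [Fintype ι] {n : ℕ∞ω} (hρ : ContDiffAt ℝ n ρ x.1)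
    (hh : ∀ i ∈ S, ContDiffAt ℝ n (h i) (x.2 i)) : ContDiffAt ℝ n (hartogsFun ρ h S) x := by
  refine (hρ.comp x contDiffAt_fst).add (ContDiffAt.sum fun i hi => ?_)
  exact (hh i hi).comp x ((proj E F i).restrictScalars ℝ).contDiff.contDiffAt

theorem fderiv_hartogsFun_apply [Finite ι] (hρ : DifferentiableAt ℝ ρ x.1)
    (hh : ∀ i ∈ S, DifferentiableAt ℝ (h i) (x.2 i)) (t : E × (∀ i, F i)) :
    fderiv ℝ (hartogsFun ρ h S) x t =
      fderiv ℝ ρ x.1 t.1 + ∑ i ∈ S, fderiv ℝ (h i) (x.2 i) (t.2 i) := by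
  cases nonempty_fintype ι
  have hfst : HasFDerivAt (fun y : E × (∀ i, F i) => ρ y.1) _ x :=
    hρ.hasFDerivAt.comp x hasFDerivAt_fst
  have hsnd (i : ι) (hi : i ∈ S) : HasFDerivAt (fun y : E × (∀ i, F i) => h i (y.2 i)) _ x :=
    (hh i hi).hasFDerivAt.comp x ((proj E F i).restrictScalars ℝ).hasFDerivAt
  have hsum : HasFDerivAt (hartogsFun ρ h S) _ x := hfst.add (HasFDerivAt.fun_sum hsnd)
  simp [hsum.fderiv, proj]

theorem leviForm_comp_clm {D : Type*} [NormedAddCommGroup D] [NormedSpace ℂ D] {f : E → ℝ}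
    (L : D →L[ℂ] E) {y : D} (hf : ContDiffAt ℝ 2 f (L y)) (t : D) :
    leviForm (fun u => f (L u)) y t = leviForm f (L y) (L t) := by
  rw [leviForm_comp hf L.contDiff.contDiffAt, L.fderiv]

theorem leviForm_hartogsFun [Fintype ι] (hρ : ContDiffAt ℝ 2 ρ x.1)
    (hh : ∀ i ∈ S, ContDiffAt ℝ 2 (h i) (x.2 i)) (t : E × (∀ i, F i)) :
    leviForm (hartogsFun ρ h S) x t =
      leviForm ρ x.1 t.1 + ∑ i ∈ S, leviForm (h i) (x.2 i) (t.2 i) := by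
  have hsnd (i : ι) (hi : i ∈ S) : ContDiffAt ℝ 2 (fun y : E × (∀ i, F i) => h i (y.2 i)) x :=
    (hh i hi).comp x ((proj E F i).restrictScalars ℝ).contDiff.contDiffAt
  have hfst : ContDiffAt ℝ 2 (fun y : E × (∀ i, F i) => ρ y.1) x := hρ.comp x contDiffAt_fst
  unfold hartogsFun
  rw [leviForm_add hfst (ContDiffAt.sum hsnd), leviForm_sum S hsnd]
  exact congrArg₂ _ (leviForm_comp_clm (.fst ℂ E _) hρ t)
    (Finset.sum_congr rfl fun i hi => leviForm_comp_clm (proj E F i) (hh i hi) t)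

end HartogsFun

section Geometry

theorem fst_mem_closure_of_mem_frontier {Z ι : Type*} [TopologicalSpace Z] [Fintype ι]
    {W : ι → Type*} [∀ i, TopologicalSpace (W i)] {Ω : Set Z} {ρ : Z → ℝ} {h : ∀ i, W i → ℝ}
    {x : Z × (∀ i, W i)} (hx : x ∈ frontier (hartogsDomain Ω ρ h)) : x.1 ∈ closure Ω :=
  map_mem_closure continuous_fst hx.1 fun _ hy => hy.1

variable {E : Type*} [NormedAddCommGroup E] [NormedSpace ℂ E] {ι : Type*} [Fintype ι]
  {F : ι → Type*} [∀ i, NormedAddCommGroup (F i)] [∀ i, NormedSpace ℂ (F i)] {Ω U : Set E}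
  {ρ : E → ℝ} {h : ∀ i, F i → ℝ} {S : Finset ι} {x : E × (∀ i, F i)}

theorem ConditionII.sum_nonneg (hh : ConditionII h) (w : ∀ i, F i) : 0 ≤ ∑ i, h i (w i) :=
  Finset.sum_nonneg fun i _ => (hh i).nonneg (w i)

theorem ConditionII.sum_eq_zero_iff (hh : ConditionII h) {w : ∀ i, F i} :
    ∑ i, h i (w i) = 0 ↔ w = 0 := by
  simp [Finset.sum_eq_zero_iff_of_nonneg fun i _ => (hh i).nonneg (w i), (hh _).eq_zero_iff,
    funext_iff]

theorem ConditionII.isBounded_sublevel (hh : ConditionII h) (c : ℝ) :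
    Bornology.IsBounded {w : ∀ i, F i | ∑ i, h i (w i) < c} := by
  have hbdd (i : ι) : Bornology.IsBounded {v : F i | h i v ≤ c} := by
    rw [Bornology.isBounded_def]
    filter_upwards [(hh i).tendsto_atTop.eventually (eventually_gt_atTop c)] with v hv
    exact not_le.2 hv
  refine (Bornology.IsBounded.pi hbdd).subset fun w hw i _ => ?_
  exact (Finset.single_le_sum (f := fun i => h i (w i)) (fun i _ => (hh i).nonneg (w i))
    (Finset.mem_univ i)).trans hw.le

theorem ConditionII.contDiffAt_hartogsFun (hh : ConditionII h) (hρ : ContDiffAt ℝ ∞ ρ x.1) :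
    ContDiffAt ℝ ∞ (hartogsFun ρ h S) x :=
  Hartogs.contDiffAt_hartogsFun hρ fun i _ => (hh i).smooth.contDiffAt

theorem ConditionII.fderiv_hartogsFun_apply (hh : ConditionII h) (hρ : ContDiffAt ℝ ∞ ρ x.1)
    (t : E × (∀ i, F i)) : fderiv ℝ (hartogsFun ρ h Finset.univ) x t =
      fderiv ℝ ρ x.1 t.1 + ∑ i, fderiv ℝ (h i) (x.2 i) (t.2 i) :=
  Hartogs.fderiv_hartogsFun_apply (hρ.differentiableAt (by simp))
    (fun i _ => (hh i).smooth.contDiffAt.differentiableAt (by simp)) t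

theorem ConditionII.exists_fderiv_hartogsFun_snd_ne_zero (hh : ConditionII h)
    (hρ : ContDiffAt ℝ ∞ ρ x.1) (hx : x.2 ≠ 0) :
    ∃ v, fderiv ℝ (hartogsFun ρ h Finset.univ) x (0, v) ≠ 0 := by
  classical
  obtain ⟨i, hi⟩ := Function.ne_iff.1 hx
  obtain ⟨v, hv⟩ := DFunLike.ne_iff.1 ((hh i).gradient_ne_zero _ hi)
  refine ⟨Pi.single i v, ?_⟩
  rw [hh.fderiv_hartogsFun_apply hρ, map_zero, zero_add, Finset.sum_eq_single i]
  · simpa using hv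
  · intro j _ hj
    simp [Pi.single_eq_of_ne hj]
  · simp

theorem ConditionII.fderiv_hartogsFun_ne_zero (hh : ConditionII h) (hρ : ContDiffAt ℝ ∞ ρ x.1)
    (hx : fderiv ℝ ρ x.1 ≠ 0) : fderiv ℝ (hartogsFun ρ h Finset.univ) x ≠ 0 := by
  obtain ⟨v, hv⟩ := DFunLike.ne_iff.1 hx
  refine DFunLike.ne_iff.2 ⟨(v, 0), ?_⟩
  simpa [hh.fderiv_hartogsFun_apply hρ] using hv

theorem mem_hartogsDomain_iff (hρ : IsDefiningFunctionOn Ω ρ U) (hh : ConditionII h)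
    (hx : x.1 ∈ U) : x ∈ hartogsDomain Ω ρ h ↔ hartogsFun ρ h Finset.univ x < 0 := by
  refine ⟨fun hx' => hx'.2, fun hx' => ⟨(hρ.mem_iff _ hx).2 ?_, hx'⟩⟩
  exact (le_add_of_nonneg_right (hh.sum_nonneg x.2)).trans_lt hx'

theorem isOpen_hartogsDomain (hΩ : IsOpen Ω) (hρ : IsDefiningFunctionOn Ω ρ U)
    (hh : ConditionII h) : IsOpen (hartogsDomain Ω ρ h) := by
  refine isOpen_iff_mem_nhds.2 fun x hx => ?_
  have hcont : ContinuousAt (hartogsFun ρ h Finset.univ) x :=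
    (hh.contDiffAt_hartogsFun (hρ.contDiffAt (hρ.closure_subset
      (subset_closure hx.1)))).continuousAt
  filter_upwards [hcont.eventually (gt_mem_nhds hx.2),
    continuousAt_fst.eventually (hΩ.eventually_mem hx.1)] with y hy hyΩ
  exact ⟨hyΩ, hy⟩

theorem hartogsFun_eq_zero_of_mem_frontier (hΩ : IsOpen Ω) (hρ : IsDefiningFunctionOn Ω ρ U)
    (hh : ConditionII h) (hx : x ∈ frontier (hartogsDomain Ω ρ h)) :
    hartogsFun ρ h Finset.univ x = 0 := by
  have hxU : x.1 ∈ U := hρ.closure_subset (fst_mem_closure_of_mem_frontier hx)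
  refine eq_zero_of_mem_frontier (isOpen_hartogsDomain hΩ hρ hh) hx
    (hh.contDiffAt_hartogsFun (hρ.contDiffAt hxU)).continuousAt ?_
  filter_upwards [continuousAt_fst.eventually (hρ.isOpen.mem_nhds hxU)] with y hy
  exact mem_hartogsDomain_iff hρ hh hy

theorem fst_mem_frontier_of_mem_frontier (hΩ : IsOpen Ω) (hρ : IsDefiningFunctionOn Ω ρ U)
    (hh : ConditionII h) (hx : x ∈ frontier (hartogsDomain Ω ρ h)) (hw : x.2 = 0) :
    x.1 ∈ frontier Ω := by
  have hcl := fst_mem_closure_of_mem_frontier hx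
  have hzero : ρ x.1 = 0 := by
    simpa [hartogsFun, hh.sum_eq_zero_iff.2 hw] using
      hartogsFun_eq_zero_of_mem_frontier hΩ hρ hh hx
  rw [hΩ.frontier_eq]
  exact ⟨hcl, fun hmem => ((hρ.mem_iff _ (hρ.closure_subset hcl)).1 hmem).ne hzero⟩

theorem IsDefiningFunctionOn.hartogsFun (hΩ : IsOpen Ω) (hρ : IsDefiningFunctionOn Ω ρ U)
    (hh : ConditionII h) : IsDefiningFunctionOn (hartogsDomain Ω ρ h)
      (hartogsFun ρ h Finset.univ) (Prod.fst ⁻¹' U) where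
  isOpen := hρ.isOpen.preimage continuous_fst
  closure_subset _ hx :=
    hρ.closure_subset (map_mem_closure continuous_fst hx fun _ hy => hy.1)
  smooth _ hx := (hh.contDiffAt_hartogsFun (hρ.contDiffAt hx)).contDiffWithinAt
  mem_iff _ hx := mem_hartogsDomain_iff hρ hh hx
  gradient_ne_zero x hx := by
    have hρx := hρ.contDiffAt (hρ.closure_subset (fst_mem_closure_of_mem_frontier hx))
    by_cases hw : x.2 = 0
    · exact hh.fderiv_hartogsFun_ne_zero hρx
        (hρ.gradient_ne_zero _ (fst_mem_frontier_of_mem_frontier hΩ hρ hh hx hw))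
    · obtain ⟨v, hv⟩ := hh.exists_fderiv_hartogsFun_snd_ne_zero hρx hw
      exact DFunLike.ne_iff.2 ⟨(0, v), hv⟩

theorem isPshOn_hartogsFun (hU : IsOpen U) (hρ : ContDiffOn ℝ ∞ ρ U) (hpsh : IsPshOn ρ U)
    (hh : ConditionII h) : IsPshOn (hartogsFun ρ h S) (Prod.fst ⁻¹' U) := by
  intro x hx t
  rw [leviForm_hartogsFun (contDiffAt_infty.1 (hρ.contDiffAt (hU.mem_nhds hx)) 2)
    fun i _ => contDiffAt_infty.1 (hh i).smooth.contDiffAt 2]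
  exact add_nonneg (hpsh _ hx _)
    (Finset.sum_nonneg fun i _ => (hh i).psh _ (Set.mem_univ _) _)

theorem leviForm_le_leviForm_hartogsFun (hU : IsOpen U) (hρ : ContDiffOn ℝ ∞ ρ U)
    (hpsh : IsPshOn ρ U) (hh : ConditionII h) (hx : x.1 ∈ U) {i : ι} (hi : i ∈ S)
    (t : E × (∀ i, F i)) :
    leviForm (h i) (x.2 i) (t.2 i) ≤ leviForm (hartogsFun ρ h S) x t := by
  rw [leviForm_hartogsFun (contDiffAt_infty.1 (hρ.contDiffAt (hU.mem_nhds hx)) 2)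
    fun i _ => contDiffAt_infty.1 (hh i).smooth.contDiffAt 2]
  refine le_add_of_nonneg_of_le (hpsh _ hx _) ?_
  exact Finset.single_le_sum (f := fun i => leviForm (h i) (x.2 i) (t.2 i))
    (fun i _ => (hh i).psh _ (Set.mem_univ _) _) hi

theorem ConditionII.isPreconnected_sublevel [∀ i, ProperSpace (F i)] (hh : ConditionII h)
    (c : ℝ) : IsPreconnected {w : ∀ i, F i | ∑ i, h i (w i) < c} := by
  have hcont : Continuous fun w : ∀ i, F i => ∑ i, h i (w i) :=
    continuous_finsetSum _ fun i _ => (hh i).smooth.continuous.comp (continuous_apply i)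
  refine Hartogs.isPreconnected_sublevel (a := 0) hcont (hh.isBounded_sublevel c)
    fun w hw hcrit => ?_
  let k := hartogsFun (fun _ : ℂ => 0) h Finset.univ
  have hk : ContDiffAt ℝ ∞ k (0, w) := hh.contDiffAt_hartogsFun contDiffAt_const
  obtain ⟨v, hv⟩ := hh.exists_fderiv_hartogsFun_snd_ne_zero (ρ := fun _ : ℂ => 0)
    (x := (0, w)) contDiffAt_const hw
  have hslice : HasFDerivAt (fun w => k (0, w)) _ w :=
    (hk.differentiableAt (by simp)).hasFDerivAt.comp w (hasFDerivAt_prodMk_right 0 w)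
  apply hv
  simpa [k, hartogsFun, hcrit] using congrArg (· v) hslice.fderiv.symm

theorem mk_zero_mem_hartogsDomain {Z : Type*} {Ω : Set Z} {ρ : Z → ℝ} {z : Z} (hz : z ∈ Ω)
    (hρ : ρ z < 0) (hh : ConditionII h) : (z, 0) ∈ hartogsDomain Ω ρ h :=
  ⟨hz, by simpa only [hh.sum_eq_zero_iff.2, add_zero] using hρ⟩

theorem isPreconnected_hartogsDomain [∀ i, ProperSpace (F i)] {Z : Type*} [TopologicalSpace Z]
    {Ω : Set Z} {ρ : Z → ℝ} (hΩ : IsPreconnected Ω) (hρ : ∀ z ∈ Ω, ρ z < 0)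
    (hh : ConditionII h) : IsPreconnected (hartogsDomain Ω ρ h) := by
  refine isPreconnected_of_fibers hΩ (w₀ := 0) ?_
    (fun z hz => mk_zero_mem_hartogsDomain hz (hρ z hz) hh) fun z hz => ?_
  · rintro _ ⟨x, hx, rfl⟩
    exact hx.1
  · convert hh.isPreconnected_sublevel (-ρ z) using 1
    ext w
    simp [hartogsDomain, hz, lt_neg_iff_add_neg']

theorem isSmoothBoundedDomain_hartogsDomain [ProperSpace E] [∀ i, ProperSpace (F i)]
    (hΩ : IsSmoothBoundedDomain Ω) (hρ : IsDefiningFunctionOn Ω ρ U) (hh : ConditionII h) :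
    IsSmoothBoundedDomain (hartogsDomain Ω ρ h) where
  isOpen := isOpen_hartogsDomain hΩ.isOpen hρ hh
  isConnected := by
    have hneg (z : E) (hz : z ∈ Ω) : ρ z < 0 :=
      (hρ.mem_iff z (hρ.closure_subset (subset_closure hz))).1 hz
    obtain ⟨z, hz⟩ := hΩ.isConnected.nonempty
    exact ⟨⟨(z, 0), mk_zero_mem_hartogsDomain hz (hneg z hz) hh⟩,
      isPreconnected_hartogsDomain hΩ.isConnected.isPreconnected hneg hh⟩
  isBounded := by
    obtain ⟨M, hM⟩ := hΩ.isBounded.isCompact_closure.bddBelow_image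
      (hρ.smooth.continuousOn.mono hρ.closure_subset)
    refine (hΩ.isBounded.prod (hh.isBounded_sublevel (-M))).subset fun x hx => ⟨hx.1, ?_⟩
    have hMx := hM (Set.mem_image_of_mem ρ (subset_closure hx.1))
    have hneg := hx.2
    simp only [Set.mem_ofPred_eq]
    linarith
  smooth_boundary _ hx :=
    ⟨_, (IsDefiningFunctionOn.hartogsFun hΩ.isOpen hρ hh).isLocalDefiningFunction
      (isOpen_hartogsDomain hΩ.isOpen hρ hh) hx⟩

end Geometry

section IncrementOrder

variable {D G : Type*} [NormedAddCommGroup D] [NormedSpace ℝ D] [NormedAddCommGroup G]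
  [NormedSpace ℝ G]

/-- The order of vanishing of `f - f z` at `z`. The numerators and the denominators in the
definition of the type have this form. -/
noncomputable def incrementOrder (f : D → G) (z : D) : ℕ∞ :=
  order (fun y => f y - f z) z

theorem one_le_incrementOrder (f : D → G) (z : D) : 1 ≤ incrementOrder f z :=
  one_le_order_iff.2 (sub_self _)

theorem incrementOrder_congr {f g : D → G} {z : D} (h : f =ᶠ[𝓝 z] g) :
    incrementOrder f z = incrementOrder g z :=
  order_congr (h.sub (by rw [h.eq_of_nhds]))

theorem incrementOrder_const (c : G) (z : D) : incrementOrder (fun _ => c) z = ⊤ := by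
  simp [incrementOrder, order]

theorem incrementOrder_le_one_of_fderiv_ne_zero {f : D → G} {z : D} (h : fderiv ℝ f z ≠ 0) :
    incrementOrder f z ≤ 1 := by
  by_contra! hlt
  have htwo : ((1 + 1 : ℕ) : ℕ∞) ≤ incrementOrder f z := by
    exact_mod_cast Order.add_one_le_of_lt hlt
  have hfderiv := one_le_order_iff.1 (succ_le_order_iff_fderiv.1 htwo).2
  exact h (by rwa [fderiv_sub_const] at hfderiv)

theorem natCast_le_incrementOrder_iff_isBigO {f : D → G} {z : D} (hf : ContDiffAt ℝ ∞ f z)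
    {n : ℕ} : (n : ℕ∞) ≤ incrementOrder f z ↔ (fun y => f y - f z) =O[𝓝 z] fun y => ‖y - z‖ ^ n :=
  le_order_iff_isBigO (contDiffAt_infty.1 (hf.sub contDiffAt_const) n)

theorem incrementOrder_le_of_isBigO {G' : Type*} [NormedAddCommGroup G'] [NormedSpace ℝ G']
    {f : D → G} {g : D → G'} {z : D} (hf : ContDiffAt ℝ ∞ f z) (hg : ContDiffAt ℝ ∞ g z)
    (h : (fun y => f y - f z) =O[𝓝 z] fun y => g y - g z) :
    incrementOrder g z ≤ incrementOrder f z :=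
  order_le_order_of_isBigO (hf.sub contDiffAt_const) (hg.sub contDiffAt_const) h

theorem exists_incrementOrder_component_le {G₁ ι : Type*} [NormedAddCommGroup G₁]
    [NormedSpace ℝ G₁] [Fintype ι] {G₂ : ι → Type*} [∀ i, NormedAddCommGroup (G₂ i)]
    [∀ i, NormedSpace ℝ (G₂ i)] {f : D → G₁ × (∀ i, G₂ i)} {z : D} (hf : ContDiffAt ℝ ∞ f z)
    (hfin : incrementOrder f z ≠ ⊤) :
    incrementOrder (fun y => (f y).1) z ≤ incrementOrder f z ∨
      ∃ i, incrementOrder (fun y => (f y).2 i) z ≤ incrementOrder f z := by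
  obtain ⟨n, hn⟩ := ENat.ne_top_iff_exists.1 hfin
  by_contra! hlt
  have hsucc {a : ℕ∞} (ha : incrementOrder f z < a) : ((n + 1 : ℕ) : ℕ∞) ≤ a := by
    rw [← hn] at ha
    exact_mod_cast Order.add_one_le_of_lt ha
  have hfst := (natCast_le_incrementOrder_iff_isBigO hf.fst).1 (hsucc hlt.1)
  have hsnd (i : ι) := (natCast_le_incrementOrder_iff_isBigO (contDiffAt_pi.1 hf.snd i)).1
    (hsucc (hlt.2 i))
  have h := (natCast_le_incrementOrder_iff_isBigO hf).2 (hfst.prod_left (isBigO_pi.2 hsnd))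
  rw [← hn] at h
  norm_cast at h
  omega

theorem le_incrementOrder_sum {ι : Type*} {s : Finset ι} {f : ι → D → G} {z : D}
    (hf : ∀ i ∈ s, ContDiffAt ℝ ∞ (f i) z) {n : ℕ}
    (h : ∀ i ∈ s, (n : ℕ∞) ≤ incrementOrder (f i) z) :
    (n : ℕ∞) ≤ incrementOrder (fun y => ∑ i ∈ s, f i y) z := by
  refine (natCast_le_incrementOrder_iff_isBigO (ContDiffAt.sum hf)).2 ?_
  simpa only [Finset.sum_sub_distrib] using
    IsBigO.fun_sum fun i hi => (natCast_le_incrementOrder_iff_isBigO (hf i hi)).1 (h i hi)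

theorem incrementOrder_add_sum_le_mul {ι : Type*} {s : Finset ι} {f : D → G} {c : ι → D → G}
    {z : D} (hf : ContDiffAt ℝ ∞ f z) (hc : ∀ i ∈ s, ContDiffAt ℝ ∞ (c i) z) {a : ℕ∞}
    (ha : 1 ≤ a)
    (h : ∀ i ∈ s, incrementOrder (fun y => f y + ∑ i ∈ s, c i y) z ≤ a * incrementOrder (c i) z) :
    incrementOrder (fun y => f y + ∑ i ∈ s, c i y) z ≤ a * incrementOrder f z := by
  set g := fun y => f y + ∑ i ∈ s, c i y
  have hg : ContDiffAt ℝ ∞ g z := hf.add (ContDiffAt.sum hc)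
  by_contra! hlt
  have hfin : incrementOrder f z ≠ ⊤ := by
    intro htop
    rw [htop, ENat.mul_top (zero_lt_one.trans_le ha).ne'] at hlt
    exact not_top_lt hlt
  obtain ⟨n, hn⟩ := ENat.ne_top_iff_exists.1 hfin
  rw [← hn] at hlt
  have hci (i : ι) (hi : i ∈ s) : ((n + 1 : ℕ) : ℕ∞) ≤ incrementOrder (c i) z := by
    exact_mod_cast Order.add_one_le_of_lt (lt_of_mul_lt_mul_left' (hlt.trans_le (h i hi)))
  have hgn : ((n + 1 : ℕ) : ℕ∞) ≤ incrementOrder g z := by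
    exact_mod_cast Order.add_one_le_of_lt ((le_mul_of_one_le_left' ha).trans_lt hlt)
  have hsub := ((natCast_le_incrementOrder_iff_isBigO hg).1 hgn).sub
    ((natCast_le_incrementOrder_iff_isBigO (ContDiffAt.sum hc)).1 (le_incrementOrder_sum hc hci))
  have hfn : ((n + 1 : ℕ) : ℕ∞) ≤ incrementOrder f z := by
    refine (natCast_le_incrementOrder_iff_isBigO hf).2 (hsub.congr_left fun y => ?_)
    simp only [g]
    abel
  rw [← hn] at hfn
  norm_cast at hfn
  omega

variable {f g : ℂ → ℝ} {z : ℂ}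

theorem incrementOrder_add_le_right (hf : ContDiffAt ℝ ∞ f z) (hg : ContDiffAt ℝ ∞ g z)
    (hlevi : ∀ᶠ ζ in 𝓝 z, ∀ t, 0 ≤ leviForm f ζ t) (hmin : ∀ᶠ ζ in 𝓝 z, g z ≤ g ζ) :
    incrementOrder (fun ζ => f ζ + g ζ) z ≤ incrementOrder g z := by
  simp only [incrementOrder, add_sub_add_comm]
  exact order_add_le_right (hf.sub contDiffAt_const) (hg.sub contDiffAt_const)
    (by simpa only [leviForm_sub_const]) (by simpa only [sub_nonneg]) (sub_self _)

theorem incrementOrder_add_le_left (hf : ContDiffAt ℝ ∞ f z) (hg : ContDiffAt ℝ ∞ g z)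
    (hlevi : ∀ᶠ ζ in 𝓝 z, ∀ t, 0 ≤ leviForm f ζ t) (hmin : ∀ᶠ ζ in 𝓝 z, g z ≤ g ζ) :
    incrementOrder (fun ζ => f ζ + g ζ) z ≤ incrementOrder f z := by
  simp only [incrementOrder, add_sub_add_comm]
  exact order_add_le_left (hf.sub contDiffAt_const) (hg.sub contDiffAt_const)
    (by simpa only [leviForm_sub_const]) (by simpa only [sub_nonneg]) (sub_self _)

theorem incrementOrder_le_two_mul {ψ : ℂ → G} (hf : ContDiffAt ℝ ∞ f z)
    (hψ : ContDiffAt ℝ ∞ ψ z) {C : ℝ}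
    (h : ∀ᶠ ζ in 𝓝 z, ‖fderiv ℝ ψ ζ‖ ^ 2 ≤ C * leviForm f ζ 1) :
    incrementOrder f z ≤ 2 * incrementOrder ψ z :=
  order_le_two_mul_order (C := C) (hf.sub contDiffAt_const) (hψ.sub contDiffAt_const)
    (sub_self _) (by simpa only [leviForm_sub_const, fderiv_sub_const] using h)

end IncrementOrder

section Typ

variable {E : Type*} [NormedAddCommGroup E] [NormedSpace ℂ E] {φ : ℂ → E} {x : E} {k : E → ℝ}
  {Ω : Set E} {r r₁ r₂ : E → ℝ}

theorem IsDiscAt.analyticAt [CompleteSpace E] (hφ : IsDiscAt φ x) : AnalyticAt ℂ φ 0 :=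
  hφ.holomorphic.analyticAt (Metric.ball_mem_nhds 0 one_pos)

theorem IsDiscAt.contDiffAt [CompleteSpace E] (hφ : IsDiscAt φ x) : ContDiffAt ℝ ∞ φ 0 :=
  hφ.analyticAt.contDiffAt.restrict_scalars ℝ

theorem isDiscAt_of_incrementOrder_ne_top (hφ : DifferentiableOn ℂ φ (Metric.ball 0 1))
    (hfin : incrementOrder φ 0 ≠ ⊤) : IsDiscAt φ (φ 0) := by
  refine ⟨hφ, rfl, ?_⟩
  contrapose! hfin
  rw [← incrementOrder_const (φ 0) (0 : ℂ)]
  exact incrementOrder_congr (eventually_of_mem (Metric.ball_mem_nhds 0 one_pos) hfin)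

theorem incrementOrder_comp_le_typ_mul (hφ : DifferentiableOn ℂ φ (Metric.ball 0 1))
    (hfin : incrementOrder φ 0 ≠ ⊤) :
    (incrementOrder (fun ζ => k (φ ζ)) 0 : ENNReal) ≤ typ k (φ 0) * incrementOrder φ 0 := by
  refine (ENNReal.div_le_iff ?_ (by simpa using hfin)).1
    (le_iSup₂_of_le φ (isDiscAt_of_incrementOrder_ne_top hφ hfin) le_rfl)
  simpa using (zero_lt_one.trans_le (one_le_incrementOrder φ 0)).ne'

theorem one_le_typ [Nontrivial E] (k : E → ℝ) (x : E) : 1 ≤ typ k x := by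
  obtain ⟨e, he⟩ := exists_ne (0 : E)
  let φ : ℂ → E := fun ζ => x + ζ • e
  have hφ : HasFDerivAt φ ((ContinuousLinearMap.toSpanSingleton ℂ e).restrictScalars ℝ) 0 :=
    ((ContinuousLinearMap.toSpanSingleton ℂ e).restrictScalars ℝ).hasFDerivAt.const_add x
  have hone : incrementOrder φ 0 = 1 := by
    refine (incrementOrder_le_one_of_fderiv_ne_zero ?_).antisymm (one_le_incrementOrder φ 0)
    rw [hφ.fderiv]
    exact DFunLike.ne_iff.2 ⟨1, by simpa using he⟩
  have hdiff : Differentiable ℂ φ := by fun_prop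
  have htyp := incrementOrder_comp_le_typ_mul (k := k) hdiff.differentiableOn (by simp [hone])
  rw [hone, ENat.toENNReal_one, mul_one, show φ 0 = x by simp [φ]] at htyp
  refine le_trans ?_ htyp
  simpa only [ENat.toENNReal_one] using ENat.toENNReal_le.2 (one_le_incrementOrder _ (0 : ℂ))

theorem IsLocalDefiningFunction.typ_le [CompleteSpace E] (h₁ : IsLocalDefiningFunction Ω x r₁)
    (h₂ : IsLocalDefiningFunction Ω x r₂) : typ r₁ x ≤ typ r₂ x := by
  refine iSup₂_mono fun φ hφ => ENNReal.div_le_div_right (ENat.toENNReal_le.2 ?_) _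
  obtain rfl := hφ.center
  refine incrementOrder_le_of_isBigO (h₂.contDiffAt.comp 0 hφ.contDiffAt)
    (h₁.contDiffAt.comp 0 hφ.contDiffAt) ?_
  simpa only [h₁.1, h₂.1, sub_zero, Function.comp_def] using
    (h₁.isBigO h₂).comp_tendsto hφ.contDiffAt.continuousAt

theorem IsLocalDefiningFunction.typ_le_bdryTyp [CompleteSpace E]
    (h : IsLocalDefiningFunction Ω x r) : typ r x ≤ bdryTyp Ω x :=
  le_iInf₂ fun _ h' => h.typ_le h'

theorem IsLocalDefiningFunction.bdryTyp_le (h : IsLocalDefiningFunction Ω x r) :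
    bdryTyp Ω x ≤ typ r x :=
  iInf₂_le r h

end Typ

section LeviBounds

variable {E : Type*} [NormedAddCommGroup E] [NormedSpace ℂ E] {f : E → ℝ} {w : E} {φ : ℂ → E}
  {z : ℂ}

theorem eventually_leviForm_comp_nonneg {V : Set E} (hV : IsOpen V) (hf : ContDiffOn ℝ 2 f V)
    (hpsh : IsPshOn f V) (hφ : ContDiffAt ℂ 2 φ z) (hz : φ z ∈ V) :
    ∀ᶠ ζ in 𝓝 z, ∀ t, 0 ≤ leviForm (fun ξ => f (φ ξ)) ζ t := by
  filter_upwards [hφ.eventually (by simp), hφ.continuousAt.eventually (hV.eventually_mem hz)]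
    with ζ hφζ hζ t
  rw [leviForm_comp (hf.contDiffAt (hV.mem_nhds hζ)) hφζ]
  exact hpsh _ hζ _

theorem continuousAt_leviForm (hf : ContDiffAt ℝ 2 f w) (t : E) :
    ContinuousAt (fun p : E × E => leviForm f p.1 p.2) (w, t) := by
  have hsnd : ContinuousAt (fun p : E × E => fderiv ℝ (fderiv ℝ f) p.1) (w, t) :=
    ((hf.fderiv_right (m := 1) (by norm_num)).fderiv_right (m := 0) (by simp)).continuousAt.comp
      (x := (w, t)) continuousAt_fst
  have hI : ContinuousAt (fun p : E × E => Complex.I • p.2) (w, t) := by fun_prop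
  exact (((hsnd.clm_apply continuousAt_snd).clm_apply continuousAt_snd).add
    ((hsnd.clm_apply hI).clm_apply hI)).div_const 4

theorem exists_lt_leviForm_on_sphere [ProperSpace E] (hf : ContDiffAt ℝ 2 f w)
    (hw : ∀ t, t ≠ 0 → 0 < leviForm f w t) :
    ∃ c > 0, ∀ᶠ y in 𝓝 w, ∀ t ∈ Metric.sphere (0 : E) 1, c < leviForm f y t := by
  have hsphere := isCompact_sphere (0 : E) 1
  obtain ⟨c, hc, hcw⟩ : ∃ c > 0, ∀ t ∈ Metric.sphere (0 : E) 1, c ≤ leviForm f w t := by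
    refine hsphere.exists_forall_le' (fun t _ => ?_) fun t ht => hw t ?_
    · exact ((continuousAt_leviForm hf t).comp (by fun_prop)).continuousWithinAt
    · exact ne_zero_of_mem_unit_sphere ⟨t, ht⟩
  refine ⟨c / 2, half_pos hc, hsphere.eventually_forall_of_forall_eventually fun t ht => ?_⟩
  exact (continuousAt_leviForm hf t).eventually
    (lt_mem_nhds ((half_lt_self hc).trans_le (hcw t ht)))

theorem exists_sq_norm_le_mul_leviForm [ProperSpace E] (hf : ContDiffAt ℝ 2 f w)
    (hw : ∀ t, t ≠ 0 → 0 < leviForm f w t) :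
    ∃ C ≥ 0, ∀ᶠ y in 𝓝 w, ∀ t, ‖t‖ ^ 2 ≤ C * leviForm f y t := by
  obtain ⟨c, hc, hsphere⟩ := exists_lt_leviForm_on_sphere hf hw
  refine ⟨c⁻¹, (inv_pos.2 hc).le, hsphere.mono fun y hy t => ?_⟩
  rcases eq_or_ne t 0 with rfl | ht
  · simp [leviForm]
  have hunit : ‖((‖t‖⁻¹ : ℝ) : ℂ) • t‖ = 1 := by simp [norm_smul, ht]
  have hlevi := hy _ (mem_sphere_zero_iff_norm.2 hunit)
  rw [leviForm_smul, Complex.norm_real, norm_inv, norm_norm, inv_pow, inv_mul_eq_div,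
    lt_div_iff₀ (by positivity)] at hlevi
  rw [inv_mul_eq_div, le_div_iff₀' hc]
  exact hlevi.le

theorem norm_fderiv_le_norm_deriv (hφ : DifferentiableAt ℂ φ z) :
    ‖fderiv ℝ φ z‖ ≤ ‖deriv φ z‖ := by
  rw [(hφ.hasFDerivAt.restrictScalars ℝ).fderiv]
  refine ContinuousLinearMap.opNorm_le_bound _ (norm_nonneg _) fun v => ?_
  rw [ContinuousLinearMap.coe_restrictScalars', fderiv_eq_smul_deriv, norm_smul, mul_comm]

theorem exists_sq_norm_fderiv_le_mul_leviForm_comp [ProperSpace E] (hf : ContDiffAt ℝ 2 f (φ z))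
    (hφ : ContDiffAt ℂ 2 φ z) (hpos : ∀ t, t ≠ 0 → 0 < leviForm f (φ z) t) :
    ∃ C ≥ 0, ∀ᶠ ζ in 𝓝 z, ‖fderiv ℝ φ ζ‖ ^ 2 ≤ C * leviForm (fun ξ => f (φ ξ)) ζ 1 := by
  obtain ⟨C, hC, hle⟩ := exists_sq_norm_le_mul_leviForm hf hpos
  refine ⟨C, hC, ?_⟩
  filter_upwards [hφ.continuousAt.eventually hle, hφ.eventually (by simp),
    hφ.continuousAt.eventually (hf.eventually (by simp))] with ζ hζ hφζ hfζ
  rw [leviForm_comp hfζ hφζ]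
  refine le_trans ?_ (hζ _)
  gcongr
  exact norm_fderiv_le_norm_deriv (hφζ.differentiableAt two_ne_zero)

theorem sq_norm_fderiv_le_of_leviForm_log_nonneg {u : ℂ → ℝ} (hu : ContDiffAt ℝ 2 u z)
    (hz : 0 < u z) (hlog : 0 ≤ leviForm (fun ζ => Real.log (u ζ)) z 1) :
    ‖fderiv ℝ u z‖ ^ 2 ≤ 4 * u z * leviForm u z 1 := by
  have hle (v : ℂ) : fderiv ℝ u z v ^ 2 ≤ 4 * u z * leviForm u z 1 * ‖v‖ ^ 2 := by
    have hlogv : 0 ≤ leviForm (fun ζ => Real.log (u ζ)) z v := by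
      rw [← mul_one v, ← smul_eq_mul, leviForm_smul]
      positivity
    have hv := sq_fderiv_le_of_leviForm_log_nonneg hu hz hlogv
    rw [← mul_one v, ← smul_eq_mul, leviForm_smul, smul_eq_mul, mul_one] at hv
    linarith [sq_nonneg (fderiv ℝ u z (Complex.I • v))]
  have hnonneg : 0 ≤ 4 * u z * leviForm u z 1 := by
    simpa using (sq_nonneg _).trans (hle 1)
  refine (Real.le_sqrt (norm_nonneg _) hnonneg).1 ?_
  refine ContinuousLinearMap.opNorm_le_bound _ (Real.sqrt_nonneg _) fun v => ?_
  rw [Real.norm_eq_abs, ← Real.sqrt_sq (norm_nonneg v), ← Real.sqrt_mul hnonneg]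
  exact Real.abs_le_sqrt (hle v)

theorem exists_sq_norm_fderiv_le_mul_leviForm_of_log {u : ℂ → ℝ} (hu : ContDiffAt ℝ 2 u z)
    (hz : 0 < u z) (hlog : ∀ᶠ ζ in 𝓝 z, ∀ t, 0 ≤ leviForm (fun ξ => Real.log (u ξ)) ζ t) :
    ∃ C ≥ 0, ∀ᶠ ζ in 𝓝 z, ‖fderiv ℝ u ζ‖ ^ 2 ≤ C * leviForm u ζ 1 := by
  refine ⟨4 * (u z + 1), by positivity, ?_⟩
  filter_upwards [hlog, hu.eventually (by simp), hu.continuousAt.eventually (lt_mem_nhds hz),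
    hu.continuousAt.eventually (gt_mem_nhds (lt_add_one (u z)))] with ζ hlogζ huζ hpos hlt
  have hle := sq_norm_fderiv_le_of_leviForm_log_nonneg huζ hpos (hlogζ 1)
  have hlevi : 0 ≤ leviForm u ζ 1 :=
    nonneg_of_mul_nonneg_right ((sq_nonneg _).trans hle) (by positivity)
  exact hle.trans (by gcongr)

theorem ConditionIIAt.exists_sq_norm_fderiv_comp_le {h : E → ℝ} (hh : ConditionIIAt h)
    (hφ : ContDiffAt ℂ 2 φ z) (hz : φ z ≠ 0) :
    ∃ C ≥ 0, ∀ᶠ ζ in 𝓝 z,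
      ‖fderiv ℝ (fun ξ => h (φ ξ)) ζ‖ ^ 2 ≤ C * leviForm (fun ξ => h (φ ξ)) ζ 1 := by
  have hpos (w : E) (hw : w ≠ 0) : 0 < h w :=
    (hh.nonneg w).lt_of_ne' (mt (hh.eq_zero_iff w).1 hw)
  have hlog : ContDiffOn ℝ 2 (fun w => Real.log (h w)) {w | w ≠ 0} :=
    (contDiff_infty.1 hh.smooth 2).contDiffOn.log fun w hw => (hpos w hw).ne'
  exact exists_sq_norm_fderiv_le_mul_leviForm_of_log
    ((contDiff_infty.1 hh.smooth 2).contDiffAt.comp z (hφ.restrict_scalars ℝ)) (hpos _ hz)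
    (eventually_leviForm_comp_nonneg (f := fun w => Real.log (h w)) isOpen_ne hlog hh.log_psh hφ hz)

end LeviBounds

section Estimate

variable {E : Type*} [NormedAddCommGroup E] [NormedSpace ℂ E] {ι : Type*} [Fintype ι]
  {F : ι → Type*} [∀ i, NormedAddCommGroup (F i)] [∀ i, NormedSpace ℂ (F i)] {U : Set E}
  {ρ : E → ℝ} {h : ∀ i, F i → ℝ} {S : Finset ι} {φ : ℂ → E × (∀ i, F i)} {z : ℂ} {i : ι}

theorem contDiffAt_snd_apply {𝕜 : Type*} [NontriviallyNormedField 𝕜] {D Z ι : Type*}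
    [NormedAddCommGroup D] [NormedSpace 𝕜 D] [NormedAddCommGroup Z] [NormedSpace 𝕜 Z] [Fintype ι]
    {W : ι → Type*} [∀ i, NormedAddCommGroup (W i)] [∀ i, NormedSpace 𝕜 (W i)] {n : ℕ∞ω}
    {φ : D → Z × (∀ i, W i)} {x : D} (hφ : ContDiffAt 𝕜 n φ x) (i : ι) :
    ContDiffAt 𝕜 n (fun y => (φ y).2 i) x :=
  contDiffAt_pi.1 hφ.snd i

theorem ConditionII.contDiffAt_hartogsFun_comp (hh : ConditionII h)
    (hρ : ContDiffAt ℝ ∞ ρ (φ z).1) (hφ : ContDiffAt ℝ ∞ φ z) :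
    ContDiffAt ℝ ∞ (fun ζ => hartogsFun ρ h S (φ ζ)) z :=
  (hh.contDiffAt_hartogsFun hρ).comp z hφ

theorem ConditionIIAt.apply_le_of_eq_zero {Z : Type*} [NormedAddCommGroup Z] [NormedSpace ℂ Z]
    {k : Z → ℝ} (hk : ConditionIIAt k) {w : Z} (hw : w = 0) (v : Z) : k w ≤ k v :=
  ((hk.eq_zero_iff w).2 hw).trans_le (hk.nonneg v)

theorem ConditionIIAt.contDiffAt_comp {Z : Type*} [NormedAddCommGroup Z] [NormedSpace ℂ Z]
    {k : Z → ℝ} {ψ : ℂ → Z} (hk : ConditionIIAt k) (hψ : ContDiffAt ℝ ∞ ψ z) :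
    ContDiffAt ℝ ∞ (fun ζ => k (ψ ζ)) z :=
  hk.smooth.contDiffAt.comp z hψ

theorem ConditionII.contDiffAt_sum_comp (hh : ConditionII h) (hφ : ContDiffAt ℝ ∞ φ z) :
    ContDiffAt ℝ ∞ (fun ζ => ∑ i ∈ S, h i ((φ ζ).2 i)) z :=
  ContDiffAt.sum fun i _ => (hh i).contDiffAt_comp (contDiffAt_snd_apply hφ i)

theorem eventually_leviForm_hartogsFun_comp_nonneg (hU : IsOpen U) (hρ : ContDiffOn ℝ ∞ ρ U)
    (hpsh : IsPshOn ρ U) (hh : ConditionII h) (hφ : ContDiffAt ℂ 2 φ z) (hz : (φ z).1 ∈ U) :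
    ∀ᶠ ζ in 𝓝 z, ∀ t, 0 ≤ leviForm (fun ξ => hartogsFun ρ h S (φ ξ)) ζ t :=
  eventually_leviForm_comp_nonneg (hU.preimage continuous_fst)
    (fun _ hx => (contDiffAt_infty.1 (hh.contDiffAt_hartogsFun
      (hρ.contDiffAt (hU.mem_nhds hx))) 2).contDiffWithinAt)
    (isPshOn_hartogsFun hU hρ hpsh hh) hφ hz

theorem eventually_leviForm_comp_le_leviForm_hartogsFun_comp (hU : IsOpen U)
    (hρ : ContDiffOn ℝ ∞ ρ U) (hpsh : IsPshOn ρ U) (hh : ConditionII h)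
    (hφ : ContDiffAt ℂ 2 φ z) (hz : (φ z).1 ∈ U) (hi : i ∈ S) :
    ∀ᶠ ζ in 𝓝 z, ∀ t, leviForm (fun ξ => h i ((φ ξ).2 i)) ζ t ≤
      leviForm (fun ξ => hartogsFun ρ h S (φ ξ)) ζ t := by
  filter_upwards [hφ.eventually (by simp),
    hφ.fst.continuousAt.eventually (hU.eventually_mem hz)] with ζ hφζ hζ t
  have hcomp := contDiffAt_snd_apply hφζ i
  have hderiv : fderiv ℂ (fun ξ => (φ ξ).2 i) ζ t = (fderiv ℂ φ ζ t).2 i := by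
    rw [show (fun ξ => (φ ξ).2 i) = proj E F i ∘ φ from rfl,
      fderiv_comp ζ (proj E F i).differentiableAt (hφζ.differentiableAt two_ne_zero),
      ContinuousLinearMap.fderiv]
    rfl
  rw [leviForm_comp (contDiff_infty.1 (hh i).smooth 2).contDiffAt hcomp, hderiv,
    leviForm_comp (contDiffAt_infty.1 (hh.contDiffAt_hartogsFun
      (hρ.contDiffAt (hU.mem_nhds hζ))) 2) hφζ]
  exact leviForm_le_leviForm_hartogsFun hU hρ hpsh hh hζ hi _

theorem incrementOrder_hartogsFun_univ_comp_le (hU : IsOpen U) (hρ : ContDiffOn ℝ ∞ ρ U)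
    (hpsh : IsPshOn ρ U) (hh : ConditionII h) (hφ : ContDiffAt ℂ ∞ φ z) (hz : (φ z).1 ∈ U)
    (hS : ∀ i ∉ S, (φ z).2 i = 0) :
    incrementOrder (fun ζ => hartogsFun ρ h Finset.univ (φ ζ)) z ≤
      incrementOrder (fun ζ => hartogsFun ρ h S (φ ζ)) z := by
  classical
  simp only [hartogsFun_univ_eq_add ρ h S]
  exact incrementOrder_add_le_left
    (hh.contDiffAt_hartogsFun_comp (hρ.contDiffAt (hU.mem_nhds hz)) (hφ.restrict_scalars ℝ))
    (hh.contDiffAt_sum_comp (hφ.restrict_scalars ℝ))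
    (eventually_leviForm_hartogsFun_comp_nonneg hU hρ hpsh hh (contDiffAt_infty.1 hφ 2) hz)
    (.of_forall fun ζ => Finset.sum_le_sum fun i hi =>
      (hh i).apply_le_of_eq_zero (hS i (Finset.mem_compl.1 hi)) _)

theorem incrementOrder_hartogsFun_univ_comp_le_component (hU : IsOpen U)
    (hρ : ContDiffOn ℝ ∞ ρ U) (hpsh : IsPshOn ρ U) (hh : ConditionII h)
    (hφ : ContDiffAt ℂ ∞ φ z) (hz : (φ z).1 ∈ U) (hi : (φ z).2 i = 0) :
    incrementOrder (fun ζ => hartogsFun ρ h Finset.univ (φ ζ)) z ≤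
      incrementOrder (fun ζ => h i ((φ ζ).2 i)) z := by
  classical
  have hsplit (ζ : ℂ) : hartogsFun ρ h Finset.univ (φ ζ) =
      hartogsFun ρ h {i}ᶜ (φ ζ) + h i ((φ ζ).2 i) := by
    rw [hartogsFun_univ_eq_add ρ h {i}ᶜ, compl_compl, Finset.sum_singleton]
  simp only [hsplit]
  have hφℝ : ContDiffAt ℝ ∞ φ z := hφ.restrict_scalars ℝ
  exact incrementOrder_add_le_right
    (hh.contDiffAt_hartogsFun_comp (hρ.contDiffAt (hU.mem_nhds hz)) hφℝ)
    ((hh i).contDiffAt_comp (contDiffAt_snd_apply hφℝ i))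
    (eventually_leviForm_hartogsFun_comp_nonneg hU hρ hpsh hh (contDiffAt_infty.1 hφ 2) hz)
    (.of_forall fun ζ => (hh i).apply_le_of_eq_zero hi _)

theorem incrementOrder_hartogsFun_comp_le_two_mul_snd [ProperSpace (F i)] (hU : IsOpen U)
    (hρ : ContDiffOn ℝ ∞ ρ U) (hpsh : IsPshOn ρ U) (hh : ConditionII h)
    (hφ : ContDiffAt ℂ ∞ φ z) (hz : (φ z).1 ∈ U) (hi : i ∈ S) (hne : (φ z).2 i ≠ 0) :
    incrementOrder (fun ζ => hartogsFun ρ h S (φ ζ)) z ≤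
      2 * incrementOrder (fun ζ => (φ ζ).2 i) z := by
  have hφ2 := contDiffAt_infty.1 hφ 2
  obtain ⟨C, hC, hle⟩ := exists_sq_norm_fderiv_le_mul_leviForm_comp
    (contDiff_infty.1 (hh i).smooth 2).contDiffAt (contDiffAt_snd_apply hφ2 i)
    ((hh i).strictly_psh _ hne)
  refine incrementOrder_le_two_mul (C := C)
    (hh.contDiffAt_hartogsFun_comp (hρ.contDiffAt (hU.mem_nhds hz)) (hφ.restrict_scalars ℝ))
    (contDiffAt_snd_apply (hφ.restrict_scalars ℝ) i) ?_
  filter_upwards [hle,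
    eventually_leviForm_comp_le_leviForm_hartogsFun_comp hU hρ hpsh hh hφ2 hz hi] with ζ hζ hlevi
  exact hζ.trans (by gcongr; exact hlevi 1)

theorem incrementOrder_hartogsFun_comp_le_two_mul_apply (hU : IsOpen U)
    (hρ : ContDiffOn ℝ ∞ ρ U) (hpsh : IsPshOn ρ U) (hh : ConditionII h)
    (hφ : ContDiffAt ℂ ∞ φ z) (hz : (φ z).1 ∈ U) (hi : i ∈ S) (hne : (φ z).2 i ≠ 0) :
    incrementOrder (fun ζ => hartogsFun ρ h S (φ ζ)) z ≤
      2 * incrementOrder (fun ζ => h i ((φ ζ).2 i)) z := by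
  have hφ2 := contDiffAt_infty.1 hφ 2
  obtain ⟨C, hC, hle⟩ := (hh i).exists_sq_norm_fderiv_comp_le (contDiffAt_snd_apply hφ2 i) hne
  refine incrementOrder_le_two_mul (C := C)
    (hh.contDiffAt_hartogsFun_comp (hρ.contDiffAt (hU.mem_nhds hz)) (hφ.restrict_scalars ℝ))
    ((hh i).contDiffAt_comp (contDiffAt_snd_apply (hφ.restrict_scalars ℝ) i)) ?_
  filter_upwards [hle,
    eventually_leviForm_comp_le_leviForm_hartogsFun_comp hU hρ hpsh hh hφ2 hz hi] with ζ hζ hlevi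
  exact hζ.trans (by gcongr; exact hlevi 1)

theorem incrementOrder_hartogsFun_comp_le_two_mul_fst (hU : IsOpen U)
    (hρ : ContDiffOn ℝ ∞ ρ U) (hpsh : IsPshOn ρ U) (hh : ConditionII h)
    (hφ : ContDiffAt ℂ ∞ φ z) (hz : (φ z).1 ∈ U) (hne : ∀ i ∈ S, (φ z).2 i ≠ 0) :
    incrementOrder (fun ζ => hartogsFun ρ h S (φ ζ)) z ≤
      2 * incrementOrder (fun ζ => ρ (φ ζ).1) z :=
  have hφℝ : ContDiffAt ℝ ∞ φ z := hφ.restrict_scalars ℝ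
  incrementOrder_add_sum_le_mul ((hρ.contDiffAt (hU.mem_nhds hz)).comp z hφℝ.fst)
    (fun i _ => (hh i).contDiffAt_comp (contDiffAt_snd_apply hφℝ i)) one_le_two fun i hi =>
      incrementOrder_hartogsFun_comp_le_two_mul_apply hU hρ hpsh hh hφ hz hi (hne i hi)

end Estimate

section BoundaryType

variable {E : Type*} [NormedAddCommGroup E] [NormedSpace ℂ E] {ι : Type*} [Fintype ι]
  {F : ι → Type*} [∀ i, NormedAddCommGroup (F i)] [∀ i, NormedSpace ℂ (F i)]
  {Ω U : Set E} {ρ : E → ℝ} {h : ∀ i, F i → ℝ} {S : Finset ι} {x : E × (∀ i, F i)}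

theorem typ_le_of_forall_component [CompleteSpace E] [∀ i, CompleteSpace (F i)]
    {k : E × (∀ i, F i) → ℝ} {T : ENNReal}
    (hfst : ∀ φ, IsDiscAt φ x → incrementOrder (fun ζ => (φ ζ).1) 0 ≠ ⊤ →
      (incrementOrder (fun ζ => k (φ ζ)) 0 : ENNReal) ≤ T * incrementOrder (fun ζ => (φ ζ).1) 0)
    (hsnd : ∀ φ, IsDiscAt φ x → ∀ i, incrementOrder (fun ζ => (φ ζ).2 i) 0 ≠ ⊤ →
      (incrementOrder (fun ζ => k (φ ζ)) 0 : ENNReal) ≤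
        T * incrementOrder (fun ζ => (φ ζ).2 i) 0) : typ k x ≤ T := by
  refine iSup₂_le fun φ hφ => ?_
  obtain rfl := hφ.center
  change (incrementOrder (fun ζ => k (φ ζ)) 0 : ENNReal) / incrementOrder φ 0 ≤ T
  by_cases hfin : incrementOrder φ 0 = ⊤
  · simp [hfin]
  refine ENNReal.div_le_of_le_mul ?_
  rcases exists_incrementOrder_component_le hφ.contDiffAt hfin with hle | ⟨i, hle⟩
  · grw [hfst φ hφ (ne_top_of_le_ne_top hfin hle), hle]
  · grw [hsnd φ hφ i (ne_top_of_le_ne_top hfin hle), hle]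

theorem IsDiscAt.incrementOrder_comp_clm_le {D Z : Type*} [NormedAddCommGroup D]
    [NormedSpace ℂ D] [NormedAddCommGroup Z] [NormedSpace ℂ Z] {φ : ℂ → D} {x : D}
    (hφ : IsDiscAt φ x) (L : D →L[ℂ] Z) {k : Z → ℝ}
    (hfin : incrementOrder (fun ζ => L (φ ζ)) 0 ≠ ⊤) :
    (incrementOrder (fun ζ => k (L (φ ζ))) 0 : ENNReal) ≤
      typ k (L x) * incrementOrder (fun ζ => L (φ ζ)) 0 := by
  obtain rfl := hφ.center
  exact incrementOrder_comp_le_typ_mul (L.differentiable.comp_differentiableOn hφ.holomorphic) hfin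

theorem typ_hartogsFun_univ_le_max [CompleteSpace E] [∀ i, ProperSpace (F i)] (hU : IsOpen U)
    (hρ : ContDiffOn ℝ ∞ ρ U) (hpsh : IsPshOn ρ U) (hh : ConditionII h) (hx : x.1 ∈ U)
    (hS : ∀ i, x.2 i ≠ 0 ↔ i ∈ S) {c : ENNReal}
    (hfst : ∀ φ, IsDiscAt φ x → (incrementOrder (fun ζ => hartogsFun ρ h S (φ ζ)) 0 : ENNReal) ≤
        c * incrementOrder (fun ζ => ρ (φ ζ).1) 0)
    (htwo : ∀ i ∈ S, 2 ≤ c * typ ρ x.1) :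
    typ (hartogsFun ρ h Finset.univ) x ≤
      max (c * typ ρ x.1) (⨆ (i : ι) (_ : x.2 i = 0), typ (h i) 0) := by
  have hsmooth {φ : ℂ → E × (∀ i, F i)} (hφ : IsDiscAt φ x) : ContDiffAt ℂ ∞ φ 0 :=
    hφ.analyticAt.contDiffAt
  have hpart {φ : ℂ → E × (∀ i, F i)} (hφ : IsDiscAt φ x) :
      incrementOrder (fun ζ => hartogsFun ρ h Finset.univ (φ ζ)) 0 ≤
        incrementOrder (fun ζ => hartogsFun ρ h S (φ ζ)) 0 :=
    incrementOrder_hartogsFun_univ_comp_le hU hρ hpsh hh (hsmooth hφ) (by rwa [hφ.center])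
      fun i hi => by rw [hφ.center]; exact not_not.1 (mt (hS i).1 hi)
  refine typ_le_of_forall_component (fun φ hφ hfin => ?_) fun φ hφ i hfin => ?_
  · have hdisc := hφ.incrementOrder_comp_clm_le (.fst ℂ E (∀ i, F i)) (k := ρ) hfin
    grw [hpart hφ, hfst φ hφ, ← le_max_left, mul_assoc]
    exact mul_le_mul_right hdisc c
  by_cases hi : x.2 i = 0
  · have hcomp := incrementOrder_hartogsFun_univ_comp_le_component hU hρ hpsh hh (hsmooth hφ)
      (by rwa [hφ.center]) (i := i) (by rwa [hφ.center])
    have hdisc := hφ.incrementOrder_comp_clm_le (proj E F i) (k := h i) hfin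
    rw [show proj E F i x = 0 from hi] at hdisc
    grw [hcomp, ← le_max_right, ← le_iSup₂ i hi]
    exact hdisc
  · have hcomp := incrementOrder_hartogsFun_comp_le_two_mul_snd hU hρ hpsh hh (hsmooth hφ)
      (by rwa [hφ.center]) ((hS i).1 hi) (by rwa [hφ.center])
    grw [hpart hφ, hcomp, ENat.toENNReal_mul, ← le_max_left, ← htwo i ((hS i).1 hi)]
    rfl

theorem bdryTyp_hartogsDomain_le_of_snd_eq_zero [CompleteSpace E] [∀ i, ProperSpace (F i)]
    (hΩ : IsOpen Ω) (hρ : IsDefiningFunctionOn Ω ρ U) (hpsh : IsPshOn ρ U) (hh : ConditionII h)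
    (hx : x ∈ frontier (hartogsDomain Ω ρ h)) (hw : x.2 = 0) :
    bdryTyp (hartogsDomain Ω ρ h) x ≤ max (bdryTyp Ω x.1) (⨆ i, typ (h i) 0) := by
  have hbdry := fst_mem_frontier_of_mem_frontier hΩ hρ hh hx hw
  have htyp := typ_hartogsFun_univ_le_max (S := ∅) (c := 1) hρ.isOpen hρ.smooth hpsh hh
    (hρ.closure_subset hbdry.1) (by simp [hw]) (by simp [hartogsFun]) (by simp)
  grw [(hρ.hartogsFun hΩ hh |>.isLocalDefiningFunction (isOpen_hartogsDomain hΩ hρ hh)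
    hx).bdryTyp_le, htyp, one_mul, (hρ.isLocalDefiningFunction hΩ hbdry).typ_le_bdryTyp]
  gcongr
  exact iSup_const_le

theorem bdryTyp_hartogsDomain_le [CompleteSpace E] [Nontrivial E] [∀ i, ProperSpace (F i)]
    (hΩ : IsOpen Ω) (hρ : IsDefiningFunctionOn Ω ρ U) (hpsh : IsPshOn ρ U) (hh : ConditionII h)
    (hx : x ∈ frontier (hartogsDomain Ω ρ h)) :
    bdryTyp (hartogsDomain Ω ρ h) x ≤
      max (2 * typ ρ x.1) (⨆ (i : ι) (_ : x.2 i = 0), typ (h i) 0) := by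
  classical
  have hxU := hρ.closure_subset (fst_mem_closure_of_mem_frontier hx)
  refine (hρ.hartogsFun hΩ hh |>.isLocalDefiningFunction (isOpen_hartogsDomain hΩ hρ hh)
    hx).bdryTyp_le.trans (typ_hartogsFun_univ_le_max (S := {i | x.2 i ≠ 0}) hρ.isOpen hρ.smooth
      hpsh hh hxU (by simp) (fun φ hφ => ?_) fun _ _ => le_mul_of_one_le_right' (one_le_typ ρ x.1))
  have hle := incrementOrder_hartogsFun_comp_le_two_mul_fst (S := {i | x.2 i ≠ 0}) hρ.isOpen
    hρ.smooth hpsh hh hφ.analyticAt.contDiffAt (by rwa [hφ.center]) (by simp [hφ.center])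
  simpa only [ENat.toENNReal_mul, ENat.toENNReal_ofNat] using ENat.toENNReal_le.2 hle

theorem isOfFiniteType_hartogsDomain [CompleteSpace E] [Nontrivial E] [∀ i, ProperSpace (F i)]
    (hΩ : IsOpen Ω) (hρ : IsDefiningFunctionOn Ω ρ U) (hpsh : IsPshOn ρ U)
    (hfin : ∀ z ∈ closure Ω, typ ρ z < ⊤) (hh : ConditionII h) :
    IsOfFiniteType (hartogsDomain Ω ρ h) := by
  intro x hx
  refine (bdryTyp_hartogsDomain_le hΩ hρ hpsh hh hx).trans_lt (max_lt ?_ ?_)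
  · exact ENNReal.mul_lt_top (by simp) (hfin _ (fst_mem_closure_of_mem_frontier hx))
  · calc ⨆ (i : ι) (_ : x.2 i = 0), typ (h i) 0 ≤ ∑ i, typ (h i) 0 :=
          iSup₂_le fun i _ => Finset.single_le_sum_of_canonicallyOrdered (f := fun i => typ (h i) 0)
            (Finset.mem_univ i)
      _ < ⊤ := ENNReal.sum_lt_top.2 fun i _ => (hh i).finite_type

end BoundaryType

end Hartogs

theorem mainTheorem9_general {E : Type*} [NormedAddCommGroup E] [NormedSpace ℂ E]
    [ProperSpace E] [Nontrivial E] {ι : Type*} [Fintype ι] {F : ι → Type*}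
    [∀ i, NormedAddCommGroup (F i)] [∀ i, NormedSpace ℂ (F i)] [∀ i, ProperSpace (F i)]
    {Ω U : Set E} {ρ : E → ℝ} {h : ∀ i, F i → ℝ} (hΩ : Hartogs.IsSmoothBoundedDomain Ω)
    (hρ : Hartogs.IsDefiningFunctionOn Ω ρ U) (hρ_psh : Hartogs.IsPshOn ρ U)
    (hρ_type : ∀ z ∈ closure Ω, Hartogs.typ ρ z < ⊤) (hh : Hartogs.ConditionII h) :
    Hartogs.IsSmoothBoundedDomain (Hartogs.hartogsDomain Ω ρ h) ∧
    Hartogs.IsPseudoconvex (Hartogs.hartogsDomain Ω ρ h) ∧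
    Hartogs.IsOfFiniteType (Hartogs.hartogsDomain Ω ρ h) ∧
    ∀ x ∈ frontier (Hartogs.hartogsDomain Ω ρ h),
      (x.2 = 0 →
        Hartogs.bdryTyp (Hartogs.hartogsDomain Ω ρ h) x
          ≤ max (Hartogs.bdryTyp Ω x.1) (⨆ i, Hartogs.typ (h i) 0)) ∧
      Hartogs.bdryTyp (Hartogs.hartogsDomain Ω ρ h) x
        ≤ max (2 * Hartogs.typ ρ x.1) (⨆ (i : ι) (_ : x.2 i = 0), Hartogs.typ (h i) 0) :=
  have hopen := Hartogs.isOpen_hartogsDomain hΩ.isOpen hρ hh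
  ⟨Hartogs.isSmoothBoundedDomain_hartogsDomain hΩ hρ hh,
    (hρ.hartogsFun hΩ.isOpen hh).isPseudoconvex hopen
      (Hartogs.isPshOn_hartogsFun hρ.isOpen hρ.smooth hρ_psh hh),
    Hartogs.isOfFiniteType_hartogsDomain hΩ.isOpen hρ hρ_psh hρ_type hh,
    fun _ hx => ⟨Hartogs.bdryTyp_hartogsDomain_le_of_snd_eq_zero hΩ.isOpen hρ hρ_psh hh hx,
      Hartogs.bdryTyp_hartogsDomain_le hΩ.isOpen hρ hρ_psh hh hx⟩⟩

theorem mainTheorem9 (n : ℕ) (hn : 0 < n) (p : ℕ) (m : Fin p → ℕ)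
    (Ω U : Set (EuclideanSpace ℂ (Fin n))) (ρ : EuclideanSpace ℂ (Fin n) → ℝ)
    (h : ∀ i : Fin p, EuclideanSpace ℂ (Fin (m i)) → ℝ)
    (hΩ : Hartogs.IsSmoothBoundedDomain Ω)
    (hρ : Hartogs.IsDefiningFunctionOn Ω ρ U)
    (hρ_psh : Hartogs.IsPshOn ρ U)
    (hρ_type : ∀ z ∈ closure Ω, Hartogs.typ ρ z < ⊤)
    (hh : Hartogs.ConditionII h) :
    Hartogs.IsSmoothBoundedDomain (Hartogs.hartogsDomain Ω ρ h) ∧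
    Hartogs.IsPseudoconvex (Hartogs.hartogsDomain Ω ρ h) ∧
    Hartogs.IsOfFiniteType (Hartogs.hartogsDomain Ω ρ h) ∧
    ∀ x ∈ frontier (Hartogs.hartogsDomain Ω ρ h),
      (x.2 = 0 →
        Hartogs.bdryTyp (Hartogs.hartogsDomain Ω ρ h) x
          ≤ max (Hartogs.bdryTyp Ω x.1) (⨆ i, Hartogs.typ (h i) 0)) ∧
      (x.2 ≠ 0 →
        Hartogs.bdryTyp (Hartogs.hartogsDomain Ω ρ h) x
          ≤ max (2 * Hartogs.typ ρ x.1)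
              (⨆ (i : Fin p) (_ : x.2 i = 0), Hartogs.typ (h i) 0)) := by
  have : Nonempty (Fin n) := ⟨⟨0, hn⟩⟩
  have ⟨hsmooth, hpsc, hfin, htyp⟩ := mainTheorem9_general hΩ hρ hρ_psh hρ_type hh
  exact ⟨hsmooth, hpsc, hfin, fun x hx => ⟨(htyp x hx).1, fun _ => (htyp x hx).2⟩⟩
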